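/- Let $n\ge 0$. For a strict partition $\mu=(\mu_1>\mu_2>\cdots>\mu_r>0)$ (possibly empty), let ${\rm SYD}_\mu=\{(i,j)\mid 1\le i\le r,\ i\le j\le \mu_i+i-1\}$ be its shifted Young diagram, and let $[n',n]=\{1'<1<2'<2<\cdots<n'<n\}$. A shifted (semistandard) set-valued tableau of shape $\mu$ is a map $T$ that assigns to each box $(i,j)\in{\rm SYD}_\mu$ a nonempty subset $T_{i,j}\subseteq[n',n]$ such that 1. $\max T_{i,j}\le\min T_{i,j+1}$ and $\max T_{i,j}\le\min T_{i+1,j}$ whenever both boxes belong to ${\rm SYD}_\mu$; 2. each unprimed letter $s$ appears at most once in each column; 3. each primed letter $s'$ appears at most once in each row; 4. the diagonal boxes $T_{i,i}$ contain unprimed letters only. Let ${\rm SSVT}_P(\mu,n)$ be the (finite) set of these tableaux, and let $$GP_\mu(x_1,\dots,x_n\mid\beta)=\sum_{T\in{\rm SSVT}_P(\mu,n)}\beta^{|T|-|\mu|}\prod_{s=1}^n x_s^{\omega_s(T)}$$ be the $K$-theoretic Schur $P$-function, where $|T|=\sum_{(i,j)}|T_{i,j}|$, $|\mu|$ is the number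 of boxes, and $\omega_s(T)$ is the total number of occurrences of $s$ and $s'$ in $T$. **Proposition.** Let $k\ge 1$, let $\tilde\delta_k=(k-1,k-2,\dots,1)$ be the shifted staircase, and let $n\ge k-1$. Then $GP_{\tilde\delta_k}(1,\dots,1\mid 1)=|{\rm SSVT}_P(\tilde\delta_k,n)|$, and this number is divisible by $3^{\binom{k-1}{2}}$. -/

import Mathlib

namespace ShiftedTableaux

/-- A strict partition: a strictly decreasing finite sequence of positive integers. -/
structure StrictPartition where
  parts : List ℕ
  sorted : parts.Pairwise (· > ·)
  pos : ∀ m ∈ parts, 0 < m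

/-- The shifted Young diagram of a strict partition. Rows and columns are numbered from `0`, so that
row `i` consists of the boxes `(i, j)` with `i ≤ j < i + μ_i`. -/
def StrictPartition.diagram (μ : StrictPartition) : Finset (ℕ × ℕ) :=
  (Finset.range μ.parts.length).biUnion fun i =>
    (Finset.Ico i (i + μ.parts.getD i 0)).image fun j => (i, j)

theorem StrictPartition.mem_diagram {μ : StrictPartition} {b : ℕ × ℕ} :
    b ∈ μ.diagram ↔
      b.1 < μ.parts.length ∧ b.1 ≤ b.2 ∧ b.2 < b.1 + μ.parts.getD b.1 0 := by
  obtain ⟨i, j⟩ := b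
  simp only [StrictPartition.diagram, Finset.mem_biUnion, Finset.mem_range, Finset.mem_image,
    Finset.mem_Ico, Prod.mk.injEq]
  constructor
  · rintro ⟨a, ha, c, hc, rfl, rfl⟩
    exact ⟨ha, hc⟩
  · rintro ⟨hi, hj⟩
    exact ⟨i, hi, j, hj, rfl, rfl⟩

/-- The shifted staircase `(k - 1, k - 2, …, 1)` (empty for `k = 1`). -/
def shiftedStaircase (k : ℕ) : StrictPartition where
  parts := (List.range' 1 (k - 1)).reverse
  sorted := by
    rw [List.pairwise_reverse]
    exact List.pairwise_lt_range'
  pos := by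
    intro m hm
    rw [List.mem_reverse, List.mem_range'_1] at hm
    omega

/-- The totally ordered alphabet `1' < 1 < 2' < 2 < ⋯ < n' < n`. The element `s : Fin n` stands for
the number `s + 1`; in the lexicographic order, the primed letter `(s, false)` comes directly before
the unprimed letter `(s, true)`. -/
abbrev Letter (n : ℕ) : Type := Fin n ×ₗ Bool

/-- The primed letter `s'`. -/
def primed {n : ℕ} (s : Fin n) : Letter n := toLex (s, false)

/-- The unprimed letter `s`. -/
def unprimed {n : ℕ} (s : Fin n) : Letter n := toLex (s, true)

/-- A filling of the boxes of the shifted diagram of `μ` with sets of letters. -/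
abbrev Filling (μ : StrictPartition) (n : ℕ) : Type := {b // b ∈ μ.diagram} → Finset (Letter n)

/-- The conditions for a filling to be a shifted (semistandard) set-valued tableau of type `P`. -/
structure IsShiftedSetValuedTableau {μ : StrictPartition} {n : ℕ} (T : Filling μ n) : Prop where
  /-- every box holds a nonempty set -/
  nonempty : ∀ b, (T b).Nonempty
  /-- `max T(i, j) ≤ min T(i, j + 1)` -/
  row_le : ∀ b c, c.1 = (b.1.1, b.1.2 + 1) → ∀ x ∈ T b, ∀ y ∈ T c, x ≤ y
  /-- `max T(i, j) ≤ min T(i + 1, j)` -/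
  col_le : ∀ b c, c.1 = (b.1.1 + 1, b.1.2) → ∀ x ∈ T b, ∀ y ∈ T c, x ≤ y
  /-- an unprimed letter appears at most once in each column -/
  unprimed_col : ∀ b c, b.1.2 = c.1.2 → ∀ s, unprimed s ∈ T b → unprimed s ∈ T c → b = c
  /-- a primed letter appears at most once in each row -/
  primed_row : ∀ b c, b.1.1 = c.1.1 → ∀ s, primed s ∈ T b → primed s ∈ T c → b = c
  /-- boxes on the main diagonal hold unprimed letters only -/
  diagonal : ∀ b, b.1.1 = b.1.2 → ∀ s, primed s ∉ T b

open Classical in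
/-- The finite set `SSVT_P(μ, n)` of shifted set-valued tableaux of shape `μ` with letters in
`{1', 1, …, n', n}`. -/
noncomputable def SSVT (μ : StrictPartition) (n : ℕ) : Finset (Filling μ n) :=
  Finset.univ.filter fun T => IsShiftedSetValuedTableau T

/-- The total number `|T|` of letters in a filling. -/
def Filling.size {μ : StrictPartition} {n : ℕ} (T : Filling μ n) : ℕ :=
  ∑ b, (T b).card

/-- The number of occurrences of `s'` and of `s` in a filling. -/
def Filling.weight {μ : StrictPartition} {n : ℕ} (T : Filling μ n) (s : Fin n) : ℕ :=
  ∑ b, ((T b).filter fun x => x = primed s ∨ x = unprimed s).card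

/-- The `K`-theoretic Schur `P`-function `GP_μ(x_1, …, x_n | β)`, as a polynomial in `x_1, …, x_n`
with coefficients in `ℤ[β]`. -/
noncomputable def GP (μ : StrictPartition) (n : ℕ) : MvPolynomial (Fin n) (Polynomial ℤ) :=
  ∑ T ∈ SSVT μ n,
    MvPolynomial.C (Polynomial.X ^ (T.size - μ.diagram.card)) *
      ∏ s, MvPolynomial.X s ^ T.weight s

end ShiftedTableaux

/-! Tableaux are counted by a transfer operator. Read the letters in increasing order, refining `s'`
and then `s` into steps of contents `m, …, 1, 0, 1, …, m`: the descending half serves `s'`, the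
ascending half `s`, and content `0` occurs once because the diagonal admits no primed letters. The
tableau conditions then say exactly that steps increase strictly along rows and columns. Stripping
off the last step is the action of a factor `1 + T d`, so the count is the value of `transfer ^ n`
on the indicator of the empty shape.

Each `T d` is idempotent, so `σ d = 1 - 2 T d` is an involution, and `σ d - 3 = -2 (1 + T d)`. Let
`P(s)` be the palindromic product of the factors `σ d - s`, with coefficients `β j`. Then `P(3)` is
`transfer` up to a power of `-2`. Three facts carry the proof: (a) the `β j` commute, by a
reflection equation (`palindrome_mul_comm`, `commute_coeff`); (b) `P(s) P(-s)` is the scalar `(1 -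
s²) ^ (2m+1)`, so the `β j` satisfy quadratic relations like those of the generators of the ring of
Schur `Q`-functions (`coeff_relation`); (c) `P` has a single factor of content `0`, so each `β j`
creates at most one new row (`coeff_formalPalindrome`).

Expand `P(3) ^ n` into monomials weighted by `3 ^ (sum of indices)`. By (c), a product of fewer than
`r` of the `β j` contributes nothing at a shape with `r` rows. By (b), a monomial with a repeated
index reduces to shorter monomials and to ones with more spread indices; and at least `r` distinct
indices have sum at least `0 + 1 + ⋯ + (r-1) = r.choose 2`. So all monomials of smaller degree
vanish, and `3 ^ r.choose 2` divides the value, the power of `2` being harmless. The staircase has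
`r = k - 1` rows. -/

namespace ShiftedTableaux

/-! ### Yang–Baxter and reflection equations; commuting palindromes -/

section Reflection

variable {A : Type*} [Ring A]

/-- The palindromic product of the factors `τ i - s` with `i` running through
`m, …, 1, 0, 1, …, m`. -/
def palindrome (τ : ℕ → A) (s : A) : ℕ → A
  | 0 => τ 0 - s
  | m + 1 => (τ (m + 1) - s) * palindrome τ s m * (τ (m + 1) - s)

/-- Relations satisfied by the operators that remove a box of given content from a shifted shape:
the quotient of the `0`-Hecke algebra of type `B` that acts on shifted shapes. -/
structure IsBoxRemoval (T : ℕ → A) : Prop where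
  idem : ∀ i, T i * T i = T i
  far : ∀ i j, i + 2 ≤ j → T i * T j = T j * T i
  up : ∀ i, T (i + 1) * T (i + 2) * T (i + 1) = 0
  down : ∀ i, T (i + 1) * T i * T (i + 1) = 0

/-- The involution attached to an idempotent. -/
def reflection (e : A) : A := 1 - (e + e)

theorem reflection_mul_self {e : A} (he : e * e = e) : reflection e * reflection e = 1 := by
  simp only [reflection, mul_add, mul_sub, add_mul, sub_mul, he, mul_one, one_mul]
  abel

section YangBaxter

variable {e f s t : A}

/-- The two products `(σ - s)(σ - t)` are linear in the involution, since `σ² = 1`; this is a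
Yang–Baxter equation whose middle factor depends on both parameters. `yangBaxter_sub` is its
companion with one sign of `s` reversed. -/
theorem yangBaxter_add (he : e * e = e) (hf : f * f = f) (hefe : e * f * e = 0)
    (hfef : f * e * f = 0) (hs : ∀ x, x * s = s * x) (ht : ∀ x, x * t = t * x) :
    (reflection e - s) * ((reflection f - s) * (reflection f - t)) * (reflection e - t) =
      (reflection f - t) * ((reflection e - s) * (reflection e - t)) * (reflection f - s) := by
  have hes' : ∀ x, e * (s * x) = s * (e * x) := fun x => by rw [← mul_assoc, hs, mul_assoc]
  have hfs' : ∀ x, f * (s * x) = s * (f * x) := fun x => by rw [← mul_assoc, hs, mul_assoc]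
  have het' : ∀ x, e * (t * x) = t * (e * x) := fun x => by rw [← mul_assoc, ht, mul_assoc]
  have hft' : ∀ x, f * (t * x) = t * (f * x) := fun x => by rw [← mul_assoc, ht, mul_assoc]
  have hts' : ∀ x, t * (s * x) = s * (t * x) := fun x => by rw [← mul_assoc, hs, mul_assoc]
  rw [mul_assoc] at hefe hfef
  simp only [reflection, mul_add, mul_sub, add_mul, sub_mul, mul_assoc, mul_one, one_mul, he, hf,
    hefe, hfef, hs e, hs f, hs t, ht e, ht f, hes', hfs', het', hft', hts', mul_zero]
  abel

theorem yangBaxter_sub (he : e * e = e) (hf : f * f = f) (hefe : e * f * e = 0)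
    (hfef : f * e * f = 0) (hs : ∀ x, x * s = s * x) (ht : ∀ x, x * t = t * x) :
    (reflection f - s) * (reflection e - t) * ((reflection f + s) * (reflection f - t)) =
      ((reflection e + s) * (reflection e - t)) * (reflection f - t) * (reflection e - s) := by
  have hes' : ∀ x, e * (s * x) = s * (e * x) := fun x => by rw [← mul_assoc, hs, mul_assoc]
  have hfs' : ∀ x, f * (s * x) = s * (f * x) := fun x => by rw [← mul_assoc, hs, mul_assoc]
  have het' : ∀ x, e * (t * x) = t * (e * x) := fun x => by rw [← mul_assoc, ht, mul_assoc]
  have hft' : ∀ x, f * (t * x) = t * (f * x) := fun x => by rw [← mul_assoc, ht, mul_assoc]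
  have hts' : ∀ x, t * (s * x) = s * (t * x) := fun x => by rw [← mul_assoc, hs, mul_assoc]
  rw [mul_assoc] at hefe hfef
  simp only [reflection, mul_add, mul_sub, add_mul, sub_mul, mul_assoc, mul_one, one_mul, he, hf,
    hefe, hfef, hs e, hs f, hs t, ht e, ht f, hes', hfs', het', hft', hts', mul_zero]
  abel

/-- Here `e` is `T 0` and `f` is `T 1`. Only `f * e * f = 0` is assumed, because `T 0 * T 1 * T 0`
need not vanish: two diagonal boxes can be removed with a box of content `1` removed in between. -/
theorem reflection_equation_base (he : e * e = e) (hf : f * f = f) (hfef : f * e * f = 0)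
    (hs : ∀ x, x * s = s * x) (ht : ∀ x, x * t = t * x) :
    (reflection e - s) * ((reflection f - s) * (reflection f - t)) * (reflection e - t) *
        ((reflection f + s) * (reflection f - t)) =
      ((reflection f + s) * (reflection f - t)) * (reflection e - t) *
        ((reflection f - s) * (reflection f - t)) * (reflection e - s) := by
  have hes' : ∀ x, e * (s * x) = s * (e * x) := fun x => by rw [← mul_assoc, hs, mul_assoc]
  have hfs' : ∀ x, f * (s * x) = s * (f * x) := fun x => by rw [← mul_assoc, hs, mul_assoc]
  have het' : ∀ x, e * (t * x) = t * (e * x) := fun x => by rw [← mul_assoc, ht, mul_assoc]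
  have hft' : ∀ x, f * (t * x) = t * (f * x) := fun x => by rw [← mul_assoc, ht, mul_assoc]
  have hts' : ∀ x, t * (s * x) = s * (t * x) := fun x => by rw [← mul_assoc, hs, mul_assoc]
  have hk : (reflection f - s) * (reflection f - t) = 1 + s * t - (s + t) * reflection f := by
    have := reflection_mul_self hf
    simp only [mul_sub, sub_mul, add_mul, this, ht (reflection f)]
    abel
  have hl : (reflection f + s) * (reflection f - t) = 1 - s * t + (s - t) * reflection f := by
    have := reflection_mul_self hf
    simp only [mul_sub, sub_mul, add_mul, this, ht (reflection f)]
    abel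
  rw [mul_assoc] at hfef
  rw [hk, hl]
  simp only [reflection, mul_add, mul_sub, add_mul, sub_mul, mul_assoc, mul_one, one_mul, he, hf,
    hfef, hs e, hs f, hs t, ht e, ht f, hes', hfs', het', hft', hts', mul_zero]
  abel

end YangBaxter

variable {T : ℕ → A} {s t : A}

/-- Dressing a solution of the reflection equation: if `Bs`, `Bt` solve it, so do `as * Bs * as` and
`at' * Bt * at'`. The Yang–Baxter relations `h1`–`h4` move the new factors through, and `gs`, `gt`
commute with the old core. -/
theorem reflection_equation_step {as at' gs gt Bs Bt L L' : A}
    (hRE : Bs * (as * at') * Bt * L = L * Bt * (as * at') * Bs)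
    (h1 : as * (gs * gt) * at' = gt * (as * at') * gs)
    (h2 : at' * (gs * gt) * as = gs * (as * at') * gt)
    (h3 : gs * at' * L' = L * gt * as) (h4 : as * gt * L = L' * at' * gs)
    (hBs : Commute Bs gt) (hBt : Commute Bt gs) :
    as * Bs * as * (gs * gt) * (at' * Bt * at') * L' =
      L' * (at' * Bt * at') * (gs * gt) * (as * Bs * as) := by
  calc as * Bs * as * (gs * gt) * (at' * Bt * at') * L'
      = as * Bs * (as * (gs * gt) * at') * Bt * at' * L' := by noncomm_ring
    _ = as * (Bs * gt) * as * at' * (gs * Bt) * at' * L' := by rw [h1]; noncomm_ring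
    _ = as * gt * Bs * as * at' * Bt * (gs * at' * L') := by
        rw [hBs.eq, ← hBt.eq]; noncomm_ring
    _ = as * gt * (Bs * (as * at') * Bt * L) * gt * as := by rw [h3]; noncomm_ring
    _ = (as * gt * L) * Bt * as * at' * Bs * gt * as := by rw [hRE]; noncomm_ring
    _ = L' * at' * (gs * Bt) * as * at' * (Bs * gt) * as := by rw [h4]; noncomm_ring
    _ = L' * at' * Bt * (gs * (as * at') * gt) * Bs * as := by
        rw [hBs.eq, ← hBt.eq]; noncomm_ring
    _ = L' * (at' * Bt * at') * (gs * gt) * (as * Bs * as) := by rw [← h2]; noncomm_ring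

theorem commute_sub_sub (hs : ∀ x, x * s = s * x) (ht : ∀ x, x * t = t * x) (e : A) :
    Commute (e - s) (e - t) :=
  ((Commute.refl e).sub_right (ht e)).sub_left ((Commute.symm (hs e)).sub_right (ht s))

theorem IsBoxRemoval.commute_palindrome (hT : IsBoxRemoval T) (hs : ∀ x, x * s = s * x)
    {r : A} (hr : ∀ x, x * r = r * x) {m j : ℕ} (hj : m + 2 ≤ j) :
    Commute (palindrome (fun i => reflection (T i)) s m) (reflection (T j) - r) := by
  have key : ∀ i, i + 2 ≤ j → Commute (reflection (T i) - s) (reflection (T j) - r) := by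
    intro i hi
    have h0 : Commute (T i) (T j) := hT.far i j hi
    have h1 : Commute (reflection (T i)) (reflection (T j)) := by
      refine ((Commute.one_left _).sub_left ?_)
      exact ((Commute.one_right _).sub_right ((h0.add_right h0))).add_left
        ((Commute.one_right _).sub_right ((h0.add_right h0)))
    exact (h1.sub_left (hs _).symm).sub_right (hr _)
  induction m with
  | zero => exact key 0 hj
  | succ m ih =>
    exact ((key _ (by omega)).mul_left (ih (by omega))).mul_left (key _ (by omega))

theorem IsBoxRemoval.reflection_equation (hT : IsBoxRemoval T) (hs : ∀ x, x * s = s * x)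
    (ht : ∀ x, x * t = t * x) (m : ℕ) :
    palindrome (fun i => reflection (T i)) s m *
          ((reflection (T (m + 1)) - s) * (reflection (T (m + 1)) - t)) *
          palindrome (fun i => reflection (T i)) t m *
          ((reflection (T (m + 1)) + s) * (reflection (T (m + 1)) - t)) =
      (reflection (T (m + 1)) + s) * (reflection (T (m + 1)) - t) *
          palindrome (fun i => reflection (T i)) t m *
          ((reflection (T (m + 1)) - s) * (reflection (T (m + 1)) - t)) *
          palindrome (fun i => reflection (T i)) s m := by
  have hst : ∀ e : A, (reflection e - s) * (reflection e - t) =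
      (reflection e - t) * (reflection e - s) := fun e => (commute_sub_sub hs ht _).eq
  induction m with
  | zero => exact reflection_equation_base (hT.idem 0) (hT.idem 1) (hT.down 0) hs ht
  | succ m ih =>
    have he := hT.idem (m + 1)
    have hf := hT.idem (m + 2)
    have hu := hT.up m
    have hd := hT.down (m + 1)
    refine reflection_equation_step ih (yangBaxter_add he hf hu hd hs ht) ?_
      (yangBaxter_sub he hf hu hd hs ht) (yangBaxter_sub hf he hd hu hs ht)
      (hT.commute_palindrome hs ht le_rfl) (hT.commute_palindrome ht hs le_rfl)
    rw [hst, hst]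
    exact yangBaxter_add he hf hu hd ht hs

theorem reflection_sub_mul_add {e : A} (he : e * e = e) (hs : ∀ x, x * s = s * x) :
    (reflection e + s) * (reflection e - s) = 1 - s * s := by
  simp only [mul_sub, add_mul, reflection_mul_self he, hs (reflection e)]
  abel

theorem reflection_add_mul_sub {e : A} (he : e * e = e) (hs : ∀ x, x * s = s * x) :
    (reflection e - s) * (reflection e + s) = 1 - s * s := by
  simp only [mul_add, sub_mul, reflection_mul_self he, hs (reflection e)]
  abel

/-- The palindromes for two central parameters commute. -/
theorem IsBoxRemoval.palindrome_mul_comm (hT : IsBoxRemoval T) (hs : ∀ x, x * s = s * x)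
    (ht : ∀ x, x * t = t * x) (hreg : ∀ x, (1 - s * s) * x = 0 → x = 0) (m : ℕ) :
    palindrome (fun i => reflection (T i)) s (m + 1) *
        palindrome (fun i => reflection (T i)) t (m + 1) =
      palindrome (fun i => reflection (T i)) t (m + 1) *
        palindrome (fun i => reflection (T i)) s (m + 1) := by
  have hRE := hT.reflection_equation hs ht m
  have he := hT.idem (m + 1)
  have hz : ∀ x, x * (1 - s * s) = (1 - s * s) * x := fun x => by
    rw [mul_sub, sub_mul, ← mul_assoc, hs, mul_assoc, hs, ← mul_assoc, mul_one, one_mul]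
  have hls : (reflection (T (m + 1)) + s) * (reflection (T (m + 1)) - t) *
      (reflection (T (m + 1)) - s) = (1 - s * s) * (reflection (T (m + 1)) - t) := by
    rw [← reflection_sub_mul_add he hs, mul_assoc, mul_assoc]
    rw [(commute_sub_sub hs ht _).eq]
  have hsl : (reflection (T (m + 1)) - s) * ((reflection (T (m + 1)) + s) *
      (reflection (T (m + 1)) - t)) = (1 - s * s) * (reflection (T (m + 1)) - t) := by
    rw [← reflection_add_mul_sub he hs, mul_assoc]
  have hts : (reflection (T (m + 1)) - s) * (reflection (T (m + 1)) - t) =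
      (reflection (T (m + 1)) - t) * (reflection (T (m + 1)) - s) :=
    (commute_sub_sub hs ht _).eq
  rw [← sub_eq_zero]
  -- The reflection equation, multiplied on both sides by `σ - s`, gives commutation only up to the
  -- factor `1 - s²`, which is cancelled here.
  apply hreg
  rw [mul_sub, sub_eq_zero]
  simp only [palindrome]
  generalize palindrome (fun i => reflection (T i)) s m = Bs at *
  generalize palindrome (fun i => reflection (T i)) t m = Bt at *
  generalize reflection (T (m + 1)) - s = a at *
  generalize reflection (T (m + 1)) - t = b at *
  generalize reflection (T (m + 1)) + s = c at *
  generalize 1 - s * s = z at *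
  calc z * (a * Bs * a * (b * Bt * b)) = a * Bs * a * (b * Bt) * (z * b) := by
        rw [← hz]; simp only [mul_assoc]; rw [← hz b]
    _ = a * (Bs * (a * b) * Bt * (c * b)) * a := by rw [← hls]; simp only [mul_assoc]
    _ = (a * (c * b)) * Bt * (a * b) * Bs * a := by rw [hRE]; simp only [mul_assoc]
    _ = z * (b * Bt * b * (a * Bs * a)) := by rw [hsl, hts]; simp only [mul_assoc]

/-- The palindromes for opposite central parameters are inverse to each other up to a scalar. -/
theorem IsBoxRemoval.palindrome_mul_neg (hT : IsBoxRemoval T) (hs : ∀ x, x * s = s * x) (m : ℕ) :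
    palindrome (fun i => reflection (T i)) s m * palindrome (fun i => reflection (T i)) (-s) m =
      (1 - s * s) ^ (2 * m + 1) := by
  have hz : ∀ x, x * (1 - s * s) = (1 - s * s) * x := fun x => by
    rw [mul_sub, sub_mul, ← mul_assoc, hs, mul_assoc, hs, ← mul_assoc, mul_one, one_mul]
  induction m with
  | zero =>
    simp only [palindrome, sub_neg_eq_add, reflection_add_mul_sub (hT.idem 0) hs]
    simp
  | succ m ih =>
    have he := reflection_add_mul_sub (hT.idem (m + 1)) hs
    simp only [palindrome, sub_neg_eq_add]
    have hz' : Commute (reflection (T (m + 1)) + s) ((1 - s * s) ^ (2 * m + 1)) :=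
      Commute.pow_right (hz _) _
    generalize palindrome (fun i => reflection (T i)) s m = Bs at *
    generalize palindrome (fun i => reflection (T i)) (-s) m = Bt at *
    generalize reflection (T (m + 1)) - s = a at *
    generalize reflection (T (m + 1)) + s = c at *
    generalize 1 - s * s = z at *
    calc a * Bs * a * (c * Bt * c) = a * (Bs * (a * c) * Bt) * c := by simp only [mul_assoc]
      _ = z * (a * (Bs * Bt)) * c := by
        rw [he, hz Bs, mul_assoc z, ← mul_assoc a, hz a]; simp only [mul_assoc]
      _ = z * (a * c) * z ^ (2 * m + 1) := by
        rw [ih, mul_assoc, mul_assoc, mul_assoc, mul_assoc, hz'.eq]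
      _ = z ^ (2 * (m + 1) + 1) := by rw [he, mul_assoc, ← pow_succ', ← pow_succ']; rfl

theorem map_palindrome {B : Type*} [Ring B] (f : A →+* B) (τ : ℕ → A) (s : A) (m : ℕ) :
    f (palindrome τ s m) = palindrome (fun i => f (τ i)) (f s) m := by
  induction m with
  | zero => simp [palindrome]
  | succ m ih => simp [palindrome, ih]

theorem map_reflection {B : Type*} [Ring B] (f : A →+* B) (e : A) :
    f (reflection e) = reflection (f e) := by
  simp [reflection]

theorem IsBoxRemoval.map {B : Type*} [Ring B] (hT : IsBoxRemoval T) (f : A →+* B) :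
    IsBoxRemoval fun i => f (T i) where
  idem i := by rw [← map_mul, hT.idem]
  far i j h := by rw [← map_mul, hT.far i j h, map_mul]
  up i := by rw [← map_mul, ← map_mul, hT.up, map_zero]
  down i := by rw [← map_mul, ← map_mul, hT.down, map_zero]

end Reflection

open Polynomial

/-! ### Quadratic relations force vanishing in low degree -/

section Vanishing

theorem choose_card_two_le_sum (s : Finset ℕ) : s.card.choose 2 ≤ ∑ i ∈ s, i := by
  induction s using Finset.induction_on_max with
  | empty => simp
  | insert a s ha ih =>
    have hn : a ∉ s := fun h => lt_irrefl _ (ha a h)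
    have hc : s.card ≤ a := by
      simpa using Finset.card_le_card (fun x hx => Finset.mem_range.2 (ha x hx) : s ⊆ Finset.range a)
    rw [Finset.card_insert_of_notMem hn, Finset.sum_insert hn, Nat.choose_succ_succ' _ 1,
      Nat.choose_one_right]
    exact Nat.add_le_add hc ih

theorem sum_sq_le_sq_sum (J : Multiset ℕ) : (J.map (· ^ 2)).sum ≤ J.sum ^ 2 := by
  induction J using Multiset.induction_on with
  | empty => simp
  | cons a J ih =>
    simp only [Multiset.map_cons, Multiset.sum_cons]
    nlinarith [Nat.zero_le (a * J.sum)]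

/-- A function on multisets of exponents that vanishes on small multisets and satisfies the
quadratic relations of the ring of Schur `Q`-functions vanishes in low degree. -/
theorem eq_zero_of_quadratic_relations {ψ : Multiset ℕ → ℤ} {κ : ℕ → ℤ} {r : ℕ}
    (h0 : ∀ J, J.card < r → ψ J = 0)
    (hrel : ∀ e K, ∑ x ∈ Finset.HasAntidiagonal.antidiagonal e, (-1) ^ x.2 * ψ (x.1 ::ₘ x.2 ::ₘ K) = κ e * ψ K)
    (J : Multiset ℕ) (hJ : J.sum < r.choose 2) : ψ J = 0 := by
  obtain ⟨n, hn⟩ : ∃ n, J.card = n := ⟨_, rfl⟩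
  induction n using Nat.strong_induction_on generalizing J with
  | _ n ihn =>
  -- Inner induction at fixed length: replacing a pair `a, a` by an unequal pair of the same sum
  -- raises the sum of squares and lowers this quantity. `sum_sq_le_sq_sum` keeps the truncated
  -- subtraction honest.
  obtain ⟨k, hk⟩ : ∃ k, J.sum ^ 2 - (J.map (· ^ 2)).sum = k := ⟨_, rfl⟩
  induction k using Nat.strong_induction_on generalizing J with
  | _ k ihk =>
  by_cases hr : n < r
  · exact h0 J (hn ▸ hr)
  by_cases hnd : J.Nodup
  · have h1 := choose_card_two_le_sum ⟨J, hnd⟩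
    have h2 : r.choose 2 ≤ n.choose 2 := Nat.choose_le_choose 2 (not_lt.1 hr)
    simp only [Finset.card_mk, hn, Finset.sum_mk, Multiset.map_id'] at h1
    omega
  · rw [Multiset.nodup_iff_ne_cons_cons] at hnd
    push Not at hnd
    obtain ⟨a, K, rfl⟩ := hnd
    simp only [Multiset.sum_cons, Multiset.card_cons, Multiset.map_cons] at hJ hn hk
    have hK : ψ K = 0 := ihn K.card (by omega) K (by omega) rfl
    have hrel' := hrel (a + a) K
    rw [hK, mul_zero, Finset.sum_eq_single (a, a)] at hrel'
    · simpa using hrel'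
    · rintro ⟨i, j⟩ hij hne
      rw [Finset.HasAntidiagonal.mem_antidiagonal] at hij
      simp only at hij
      have hia : i ≠ a := by
        rintro rfl
        exact hne (by simp; omega)
      have hz : ψ (i ::ₘ j ::ₘ K) = 0 := by
        have hsum : (i ::ₘ j ::ₘ K).sum = a + (a + K.sum) := by
          simp only [Multiset.sum_cons]; omega
        refine ihk _ ?_ _ (by omega) (by simp; omega) rfl
        have hle := sum_sq_le_sq_sum (i ::ₘ j ::ₘ K)
        rw [hsum] at hle ⊢
        simp only [Multiset.map_cons, Multiset.sum_cons] at hle ⊢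
        have hlt : a ^ 2 + a ^ 2 < i ^ 2 + j ^ 2 := by
          zify at hij hia ⊢
          have : (0 : ℤ) < (i - a) ^ 2 := by
            have := sub_ne_zero.2 hia
            positivity
          nlinarith
        omega
      simp [hz]
    · intro h
      simp at h

variable {A : Type*} [Ring A]

/-- The product of commuting elements `β j`, where `j` runs through a multiset. -/
def multisetProd (β : ℕ → A) (hβ : ∀ i j, Commute (β i) (β j)) (J : Multiset ℕ) : A :=
  (J.map β).noncommProd (by
    intro x hx y hy _
    obtain ⟨i, -, rfl⟩ := Multiset.mem_map.1 hx
    obtain ⟨j, -, rfl⟩ := Multiset.mem_map.1 hy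
    exact hβ i j)

theorem multisetProd_zero (β : ℕ → A) (hβ : ∀ i j, Commute (β i) (β j)) :
    multisetProd β hβ 0 = 1 := by
  simp [multisetProd]

theorem multisetProd_cons (β : ℕ → A) (hβ : ∀ i j, Commute (β i) (β j)) (a : ℕ) (J : Multiset ℕ) :
    multisetProd β hβ (a ::ₘ J) = β a * multisetProd β hβ J := by
  simp [multisetProd]

theorem multisetProd_cons' (β : ℕ → A) (hβ : ∀ i j, Commute (β i) (β j)) (a : ℕ)
    (J : Multiset ℕ) : multisetProd β hβ (a ::ₘ J) = multisetProd β hβ J * β a := by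
  simp only [multisetProd, Multiset.map_cons, Multiset.noncommProd_cons']

/-- Each monomial of the expanded power carries `q` to the sum of its indices, so it either vanishes
under `φ` or is divisible by `q ^ N`. The induction on `n` accumulates the chosen indices in a
multiset `J`. -/
theorem pow_dvd_of_vanishing {β : ℕ → A} (hβ : ∀ i j, Commute (β i) (β j)) (φ : A →+ ℤ) {q : ℤ}
    {N D : ℕ} (h : ∀ J : Multiset ℕ, J.sum < N → φ (multisetProd β hβ J) = 0) (n : ℕ) :
    q ^ N ∣ φ ((∑ j ∈ Finset.range D, q ^ j • β j) ^ n) := by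
  have key : ∀ n (J : Multiset ℕ), q ^ N ∣ q ^ J.sum *
      φ (multisetProd β hβ J * (∑ j ∈ Finset.range D, q ^ j • β j) ^ n) := by
    intro n
    induction n with
    | zero =>
      intro J
      rcases lt_or_ge J.sum N with hJ | hJ
      · simp [h J hJ]
      · exact Dvd.dvd.mul_right (pow_dvd_pow q hJ) _
    | succ n ih =>
      intro J
      rw [pow_succ', ← mul_assoc, Finset.mul_sum, Finset.sum_mul, map_sum, Finset.mul_sum]
      refine Finset.dvd_sum fun j _ => ?_
      have := ih (j ::ₘ J)
      rw [multisetProd_cons', Multiset.sum_cons, add_comm, pow_add, mul_assoc] at this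
      rwa [mul_smul_comm, smul_mul_assoc, map_zsmul, smul_eq_mul]
  simpa [multisetProd_zero] using key n 0

variable {T : ℕ → A}

/-- The palindrome with a formal parameter. -/
noncomputable def formalPalindrome (T : ℕ → A) (m : ℕ) : A[X] :=
  palindrome (fun i => reflection (C (T i))) X m

/-- Apply `palindrome_mul_comm` in `A[X][X]` with the two independent central variables `C X` and
`X`, and compare coefficients. -/
theorem IsBoxRemoval.commute_coeff (hT : IsBoxRemoval T) (m i j : ℕ) :
    Commute ((formalPalindrome T (m + 1)).coeff i) ((formalPalindrome T (m + 1)).coeff j) := by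
  have hs : ∀ x : A[X][X], x * C X = C X * x := by
    intro x
    ext a b
    simp [coeff_mul_C, coeff_C_mul, X_mul]
  have h := ((hT.map C).map C).palindrome_mul_comm hs (fun x => (X_mul (p := x)).symm) (by
    intro x hx
    -- Coefficientwise, `1 - s²` acts as the negative of a monic polynomial, hence is regular over
    -- any ring.
    have hm : (X ^ 2 - C 1 : A[X]).Monic := monic_X_pow_sub_C 1 two_ne_zero
    ext1 k
    rw [coeff_zero, ← hm.mul_right_eq_zero_iff, ← neg_eq_zero, ← neg_mul]
    have hk := congrArg (fun y => coeff y k) hx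
    rw [← C_mul, ← C_1, ← C_sub, coeff_zero, coeff_C_mul] at hk
    rw [← hk]
    congr 1
    rw [C_1, neg_sub, sq]) m
  have h1 : palindrome (fun i => reflection (C (C (T i)))) (C X) (m + 1) =
      C (formalPalindrome T (m + 1)) := by
    rw [formalPalindrome, map_palindrome C]
    simp only [map_reflection]
  have h2 : palindrome (fun i => reflection (C (C (T i)))) X (m + 1) =
      (formalPalindrome T (m + 1)).map C := by
    rw [formalPalindrome, ← coe_mapRingHom, map_palindrome]
    simp only [map_reflection, coe_mapRingHom, map_C, map_X]
  rw [h1, h2] at h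
  have h3 := congrArg (fun y => (coeff y j).coeff i) h
  simpa [coeff_C_mul, coeff_mul_C, coeff_map, commute_iff_eq] using h3

theorem coeff_palindrome_neg (τ : ℕ → A) (m j : ℕ) :
    (palindrome (fun i => C (τ i)) (-X) m).coeff j =
      (-1 : ℤ) ^ j • (palindrome (fun i => C (τ i)) X m).coeff j := by
  have hmul : ∀ p p' q q' : A[X], (∀ j, p'.coeff j = (-1 : ℤ) ^ j • p.coeff j) →
      (∀ j, q'.coeff j = (-1 : ℤ) ^ j • q.coeff j) →
      ∀ j, (p' * q').coeff j = (-1 : ℤ) ^ j • (p * q).coeff j := by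
    intro p p' q q' hp hq j
    rw [coeff_mul, coeff_mul, Finset.smul_sum]
    refine Finset.sum_congr rfl fun x hx => ?_
    rw [hp, hq, smul_mul_smul_comm, ← pow_add, Finset.HasAntidiagonal.mem_antidiagonal.1 hx]
  have hlin : ∀ i j, (C (τ i) - -X).coeff j = (-1 : ℤ) ^ j • (C (τ i) - X).coeff j := by
    intro i j
    rw [coeff_sub, coeff_sub, coeff_neg, coeff_C, coeff_X]
    rcases j with _ | _ | j <;> simp
  induction m generalizing j with
  | zero => exact hlin 0 j
  | succ m ih => exact hmul _ _ _ _ (hmul _ _ _ _ (hlin _) ih) (hlin _) j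

/-- Compare coefficients in `P(X) P(-X) = (1 - X²) ^ (2m+1)`, whose right side has integer
coefficients. -/
theorem IsBoxRemoval.coeff_relation (hT : IsBoxRemoval T) (m : ℕ) : ∃ κ : ℕ → ℤ, ∀ e,
    ∑ x ∈ Finset.HasAntidiagonal.antidiagonal e, (-1 : ℤ) ^ x.2 •
      ((formalPalindrome T m).coeff x.1 * (formalPalindrome T m).coeff x.2) = κ e • (1 : A) := by
  refine ⟨fun e => ((1 - X * X : ℤ[X]) ^ (2 * m + 1)).coeff e, fun e => ?_⟩
  have h := (hT.map C).palindrome_mul_neg (s := X) (fun x => (X_mul (p := x)).symm) m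
  have hC : (fun i => reflection (C (T i))) = fun i => C (reflection (T i)) := by
    simp only [map_reflection]
  have hmap : (1 - X * X : A[X]) ^ (2 * m + 1) =
      ((1 - X * X : ℤ[X]) ^ (2 * m + 1)).map (Int.castRingHom A) := by simp
  rw [hmap] at h
  have he := congrArg (fun y => coeff y e) h
  simp only [coeff_map, eq_intCast] at he
  rw [zsmul_one, ← he, coeff_mul]
  refine Finset.sum_congr rfl fun x _ => ?_
  rw [formalPalindrome, hC, coeff_palindrome_neg, mul_smul_comm]

/-- The palindromic product of the factors `1 + T i` with `i` running through
`m, …, 1, 0, 1, …, m`. -/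
def transfer (T : ℕ → A) : ℕ → A
  | 0 => 1 + T 0
  | m + 1 => (1 + T (m + 1)) * transfer T m * (1 + T (m + 1))

theorem palindrome_three (T : ℕ → A) (m : ℕ) :
    palindrome (fun i => reflection (T i)) 3 m = (-2 : ℤ) ^ (2 * m + 1) • transfer T m := by
  have h : ∀ e : A, reflection e - 3 = (-2 : ℤ) • (1 + e) := fun e => by
    rw [reflection, show (3 : A) = 1 + 1 + 1 by norm_num]
    module
  induction m with
  | zero => simp [palindrome, transfer, h]
  | succ m ih =>
    simp only [palindrome, transfer, ih, h, smul_mul_assoc, mul_smul_comm, smul_smul]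
    congr 1
    ring

theorem palindrome_eq_sum (T : ℕ → A) (m : ℕ) : ∃ D,
    palindrome (fun i => reflection (T i)) 3 m =
      ∑ j ∈ Finset.range D, (3 : ℤ) ^ j • (formalPalindrome T m).coeff j := by
  have hc : ∀ a : A, Commute (RingHom.id A a) 3 := fun a => (Nat.cast_commute 3 a).symm
  have h := map_palindrome (eval₂RingHom' (RingHom.id A) 3 hc) (fun i => reflection (C (T i))) X m
  have h1 : ∀ p, eval₂RingHom' (RingHom.id A) 3 hc p = eval₂ (RingHom.id A) 3 p := fun _ => rfl
  simp only [map_reflection] at h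
  simp only [h1, eval₂_C, eval₂_X, RingHom.id_apply] at h
  refine ⟨(formalPalindrome T m).natDegree + 1, ?_⟩
  rw [← h, ← formalPalindrome, eval₂_eq_sum_range]
  refine Finset.sum_congr rfl fun j _ => ?_
  rw [RingHom.id_apply, zsmul_eq_mul]
  push_cast
  exact ((hc _).pow_right j).eq

/-- If a functional vanishes on all short products of coefficients of the palindrome, then its value
at a power of the transfer operator is divisible by a high power of `3`. -/
theorem IsBoxRemoval.pow_three_dvd (hT : IsBoxRemoval T) (m r : ℕ) (φ : A →+ ℤ)
    (hφ : ∀ J : Multiset ℕ, J.card < r →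
      φ (multisetProd (formalPalindrome T (m + 1)).coeff (hT.commute_coeff m) J) = 0) (n : ℕ) :
    3 ^ r.choose 2 ∣ φ (transfer T (m + 1) ^ n) := by
  obtain ⟨κ, hκ⟩ := hT.coeff_relation (m + 1)
  obtain ⟨D, hD⟩ := palindrome_eq_sum T (m + 1)
  have hrel : ∀ e K, ∑ x ∈ Finset.HasAntidiagonal.antidiagonal e, (-1) ^ x.2 *
      φ (multisetProd (formalPalindrome T (m + 1)).coeff (hT.commute_coeff m)
        (x.1 ::ₘ x.2 ::ₘ K)) =
      κ e * φ (multisetProd (formalPalindrome T (m + 1)).coeff (hT.commute_coeff m) K) := by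
    intro e K
    have h := congrArg (fun y => φ (y *
      multisetProd (formalPalindrome T (m + 1)).coeff (hT.commute_coeff m) K)) (hκ e)
    simpa only [Finset.sum_mul, map_sum, smul_mul_assoc, multisetProd_cons, mul_assoc, map_zsmul,
      smul_eq_mul, one_mul] using h
  have h := pow_dvd_of_vanishing (hT.commute_coeff m) φ (q := 3) (D := D)
    (eq_zero_of_quadratic_relations hφ hrel) n
  rw [← hD, palindrome_three, _root_.smul_pow, map_zsmul, smul_eq_mul] at h
  refine IsCoprime.dvd_of_dvd_mul_left ?_ h
  refine IsCoprime.pow (IsCoprime.pow_right ?_)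
  -- Bézout: `3 + (-2) = 1`.
  exact ⟨1, 1, by norm_num⟩

end Vanishing

/-! ### Box removal operators on shapes and the row bound -/

section Shapes

/-- The shape whose diagonal of content `d` has `c d` boxes has a removable box of content `d`. -/
def Removable (c : ℕ → ℕ) (d : ℕ) : Prop :=
  c d = c (d + 1) + 1 ∧ ∀ e, e + 1 = d → c e = c d

/-- Removal of a box of content `d`. -/
def removeBox (c : ℕ → ℕ) (d : ℕ) : ℕ → ℕ := Function.update c d (c d - 1)

open Classical in
/-- The operator on functions of shapes that is attached to the removal of boxes of content `d`. -/
noncomputable def removal (d : ℕ) : Module.End ℤ ((ℕ → ℕ) → ℤ) where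
  toFun f c := if Removable c d then f c + f (removeBox c d) else 0
  map_add' f g := by
    ext c
    by_cases h : Removable c d <;> simp [h]
    ring
  map_smul' a f := by
    ext c
    by_cases h : Removable c d <;> simp [h]
    ring

theorem removal_apply_of_removable {c : ℕ → ℕ} {d : ℕ} (h : Removable c d) (f : (ℕ → ℕ) → ℤ) :
    removal d f c = f c + f (removeBox c d) := if_pos h

theorem removal_apply_of_not_removable {c : ℕ → ℕ} {d : ℕ} (h : ¬ Removable c d)
    (f : (ℕ → ℕ) → ℤ) : removal d f c = 0 := if_neg h

theorem removeBox_self (c : ℕ → ℕ) (d : ℕ) : removeBox c d d = c d - 1 :=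
  Function.update_self ..

theorem removeBox_of_ne {d e : ℕ} (c : ℕ → ℕ) (h : e ≠ d) : removeBox c d e = c e :=
  Function.update_of_ne h ..

theorem removable_succ {c : ℕ → ℕ} {d : ℕ} :
    Removable c (d + 1) ↔ c (d + 1) = c (d + 2) + 1 ∧ c d = c (d + 1) := by
  simp [Removable]

theorem removable_removeBox_iff {c : ℕ → ℕ} {i j : ℕ} (h : i + 2 ≤ j ∨ j + 2 ≤ i) :
    Removable (removeBox c i) j ↔ Removable c j := by
  have h1 : removeBox c i j = c j := removeBox_of_ne _ (by omega)
  have h2 : removeBox c i (j + 1) = c (j + 1) := removeBox_of_ne _ (by omega)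
  have h3 : ∀ e, e + 1 = j → removeBox c i e = c e := fun e he => removeBox_of_ne _ (by omega)
  simp only [Removable, h1, h2]
  refine and_congr_right fun _ => forall₂_congr fun e he => ?_
  rw [h3 e he]

/-- The operators act on functions, so the leftmost factor removes its box first. Two boxes of
content `i + 1` cannot be removed without removing boxes of both contents `i` and `i + 2` in
between; this gives `up` and `down`. -/
theorem isBoxRemoval_removal : IsBoxRemoval removal where
  idem i := by
    ext f c
    rw [Module.End.mul_apply]
    by_cases h : Removable c i
    · have h' : ¬ Removable (removeBox c i) i := by
        have h0 := h.1
        have h1 := removeBox_self c i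
        have h2 := removeBox_of_ne (d := i) (e := i + 1) c (by omega)
        rintro ⟨h3, -⟩
        omega
      rw [removal_apply_of_removable h, removal_apply_of_not_removable h', add_zero]
    · simp only [removal_apply_of_not_removable h]
  far i j hij := by
    ext f c
    simp only [Module.End.mul_apply]
    have hji := removable_removeBox_iff (c := c) (i := i) (j := j) (Or.inl hij)
    have hij' := removable_removeBox_iff (c := c) (i := j) (j := i) (Or.inr hij)
    by_cases h1 : Removable c i <;> by_cases h2 : Removable c j
    · have hcomm : removeBox (removeBox c i) j = removeBox (removeBox c j) i := by
        rw [removeBox, removeBox_of_ne c (show j ≠ i by omega), removeBox,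
          Function.update_comm (by omega)]
        rw [removeBox, removeBox_of_ne c (show i ≠ j by omega), removeBox]
      rw [removal_apply_of_removable h1, removal_apply_of_removable h2,
        removal_apply_of_removable h2, removal_apply_of_removable (hji.2 h2),
        removal_apply_of_removable h1, removal_apply_of_removable (hij'.2 h1), hcomm]
      ring
    · rw [removal_apply_of_removable h1, removal_apply_of_not_removable h2,
        removal_apply_of_not_removable h2, removal_apply_of_not_removable (mt hji.1 h2), add_zero]
    · rw [removal_apply_of_removable h2, removal_apply_of_not_removable h1,
        removal_apply_of_not_removable h1, removal_apply_of_not_removable (mt hij'.1 h1), add_zero]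
    · rw [removal_apply_of_not_removable h1, removal_apply_of_not_removable h2]
  up i := by
    ext f c
    simp only [Module.End.mul_apply]
    by_cases h : Removable c (i + 1)
    · have h2 : ¬ Removable c (i + 2) := fun h' => by
        rw [removable_succ] at h
        have : c (i + 1) = c (i + 2) := ((removable_succ (d := i + 1)).1 h').2
        omega
      rw [removal_apply_of_removable h, removal_apply_of_not_removable h2, zero_add]
      have e0 := removeBox_of_ne (d := i + 1) (e := i) c (by omega)
      have e1 := removeBox_self c (i + 1)
      have e2 := removeBox_of_ne (d := i + 1) (e := i + 2) c (by omega)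
      by_cases h3 : Removable (removeBox c (i + 1)) (i + 2)
      · rw [removal_apply_of_removable h3]
        have f0 := removeBox_of_ne (d := i + 2) (e := i) (removeBox c (i + 1)) (by omega)
        have f1 := removeBox_of_ne (d := i + 2) (e := i + 1) (removeBox c (i + 1)) (by omega)
        rw [removal_apply_of_not_removable, removal_apply_of_not_removable]
        · rfl
        · intro h4
          rw [removable_succ] at h h4
          omega
        · intro h4
          rw [removable_succ] at h h4
          omega
      · rw [removal_apply_of_not_removable h3]
        rfl
    · rw [removal_apply_of_not_removable h]
      rfl
  down i := by
    ext f c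
    simp only [Module.End.mul_apply]
    by_cases h : Removable c (i + 1)
    · have h2 : ¬ Removable c i := fun h' => by
        rw [removable_succ] at h
        have := h'.1
        omega
      rw [removal_apply_of_removable h, removal_apply_of_not_removable h2, zero_add]
      have e1 := removeBox_self c (i + 1)
      have e2 := removeBox_of_ne (d := i + 1) (e := i + 2) c (by omega)
      have e0 := removeBox_of_ne (d := i + 1) (e := i) c (by omega)
      by_cases h3 : Removable (removeBox c (i + 1)) i
      · rw [removal_apply_of_removable h3]
        have f0 := removeBox_self (removeBox c (i + 1)) i
        have f1 := removeBox_of_ne (d := i) (e := i + 1) (removeBox c (i + 1)) (by omega)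
        have f2 := removeBox_of_ne (d := i) (e := i + 2) (removeBox c (i + 1)) (by omega)
        rw [removal_apply_of_not_removable, removal_apply_of_not_removable]
        · rfl
        · intro h4
          rw [removable_succ] at h h4
          omega
        · intro h4
          rw [removable_succ] at h h4
          omega
      · rw [removal_apply_of_not_removable h3]
        rfl
    · rw [removal_apply_of_not_removable h]
      rfl

/-- The function `f` vanishes on the shapes with more than `k` rows. -/
def VanishesAbove (k : ℕ) (f : (ℕ → ℕ) → ℤ) : Prop := ∀ c, k < c 0 → f c = 0

theorem VanishesAbove.mono {k l : ℕ} {f : (ℕ → ℕ) → ℤ} (h : VanishesAbove k f) (hkl : k ≤ l) :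
    VanishesAbove l f := fun c hc => h c (by omega)

theorem VanishesAbove.sub {k : ℕ} {f g : (ℕ → ℕ) → ℤ} (hf : VanishesAbove k f)
    (hg : VanishesAbove k g) : VanishesAbove k (f - g) := fun c hc => by
  rw [Pi.sub_apply, hf c hc, hg c hc, sub_zero]

theorem VanishesAbove.reflection_zero {k : ℕ} {f : (ℕ → ℕ) → ℤ} (h : VanishesAbove k f) :
    VanishesAbove (k + 1) (reflection (removal 0) f) := by
  intro c hc
  have h0 : removal 0 f c = 0 := by
    by_cases hr : Removable c 0
    · rw [removal_apply_of_removable hr, h c (by omega), zero_add, h]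
      rw [removeBox_self]
      omega
    · exact removal_apply_of_not_removable hr f
  simp [reflection, h0, h c (by omega)]

theorem VanishesAbove.reflection_succ {k : ℕ} {f : (ℕ → ℕ) → ℤ} (h : VanishesAbove k f) (i : ℕ) :
    VanishesAbove k (reflection (removal (i + 1)) f) := by
  intro c hc
  have h0 : removal (i + 1) f c = 0 := by
    by_cases hr : Removable c (i + 1)
    · rw [removal_apply_of_removable hr, h c hc, zero_add, h]
      rwa [removeBox_of_ne _ (by omega)]
    · exact removal_apply_of_not_removable hr f
  simp [reflection, h0, h c hc]

theorem VanishesAbove.coeff_formalPalindrome {k : ℕ} {f : (ℕ → ℕ) → ℤ} (h : VanishesAbove k f)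
    (m j : ℕ) : VanishesAbove (k + 1) ((formalPalindrome removal m).coeff j f) := by
  have hX : ∀ (p : (Module.End ℤ ((ℕ → ℕ) → ℤ))[X]) (l : ℕ) (g : (ℕ → ℕ) → ℤ),
      (∀ j, VanishesAbove l (p.coeff j g)) → ∀ j, VanishesAbove l ((X * p).coeff j g) := by
    intro p l g hp j
    rcases j with _ | j
    · rw [coeff_X_mul_zero]
      exact fun _ _ => rfl
    · rw [coeff_X_mul]
      exact hp j
  have hC : ∀ i, reflection (C (removal i)) = C (reflection (removal i)) := fun i =>
    (map_reflection C _).symm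
  have hmul : ∀ (i : ℕ) (p : (Module.End ℤ ((ℕ → ℕ) → ℤ))[X]) (j : ℕ) (g : (ℕ → ℕ) → ℤ),
      ((reflection (C (removal i)) - X) * p).coeff j g =
        reflection (removal i) (p.coeff j g) - (X * p).coeff j g := by
    intro i p j g
    rw [hC, sub_mul, coeff_sub, coeff_C_mul, LinearMap.sub_apply, Module.End.mul_apply]
  have hone : ∀ j, VanishesAbove k ((1 : (Module.End ℤ ((ℕ → ℕ) → ℤ))[X]).coeff j f) := by
    intro j
    rw [coeff_one]
    split_ifs
    · exact h
    · exact fun _ _ => rfl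
  have hlin : ∀ i j, VanishesAbove k ((reflection (C (removal (i + 1))) - X).coeff j f) := by
    intro i j
    have := hmul (i + 1) 1 j f
    rw [mul_one] at this
    rw [this]
    exact ((hone j).reflection_succ i).sub (hX 1 k f hone j)
  -- A right factor `q` is carried along because the palindrome grows on both sides; only its
  -- central factor, of content `0`, raises the bound.
  have hmain : ∀ q : (Module.End ℤ ((ℕ → ℕ) → ℤ))[X], (∀ j, VanishesAbove k (q.coeff j f)) →
      ∀ j, VanishesAbove (k + 1) ((formalPalindrome removal m * q).coeff j f) := by
    induction m with
    | zero =>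
      intro q hq j
      rw [formalPalindrome, palindrome, hmul]
      exact (hq j).reflection_zero.sub ((hX q k f hq j).mono k.le_succ)
    | succ m ih =>
      intro q hq
      have h1 : ∀ j, VanishesAbove k (((reflection (C (removal (m + 1))) - X) * q).coeff j f) := by
        intro j
        rw [hmul]
        exact ((hq j).reflection_succ m).sub (hX q k f hq j)
      have h2 := ih _ h1
      intro j
      rw [formalPalindrome, palindrome, mul_assoc, mul_assoc, hmul]
      exact ((h2 j).reflection_succ m).sub (hX _ _ f h2 j)
  simpa using hmain 1 hone j

open Classical in
/-- The indicator function of the empty shape. -/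
noncomputable def emptyShape (c : ℕ → ℕ) : ℤ := if ∀ d, c d = 0 then 1 else 0

theorem vanishesAbove_emptyShape : VanishesAbove 0 emptyShape := fun _ hc =>
  if_neg fun h => hc.ne' (h 0)

/-- The values of the powers of the transfer operator at the indicator function of the empty shape
are divisible by high powers of `3`. -/
theorem pow_three_dvd_transfer_emptyShape (m n : ℕ) (c : ℕ → ℕ) :
    (3 : ℤ) ^ (c 0).choose 2 ∣ (transfer removal (m + 1) ^ n) emptyShape c := by
  let φ : Module.End ℤ ((ℕ → ℕ) → ℤ) →+ ℤ :=
    { toFun := fun F => F emptyShape c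
      map_zero' := rfl
      map_add' := fun _ _ => rfl }
  refine isBoxRemoval_removal.pow_three_dvd m (c 0) φ (fun J hJ => ?_) n
  have key : ∀ J : Multiset ℕ, VanishesAbove J.card (multisetProd
      (formalPalindrome removal (m + 1)).coeff (isBoxRemoval_removal.commute_coeff m) J
        emptyShape) := by
    intro J
    induction J using Multiset.induction_on with
    | empty =>
      rw [multisetProd_zero]
      exact vanishesAbove_emptyShape
    | cons a J ih =>
      rw [multisetProd_cons, Module.End.mul_apply, Multiset.card_cons]
      exact ih.coeff_formalPalindrome _ _
  exact key J c hJ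

end Shapes

/-! ### Counting step tableaux by products of removal operators -/

section StepTableaux

/-- The lengths `c d` of the diagonals of a shifted Young diagram. -/
def IsShape (c : ℕ → ℕ) : Prop := ∀ d, c (d + 1) ≤ c d ∧ c d ≤ c (d + 1) + 1

/-- A filling of the shape `c` with sets of steps `q < p`. The box `b` lies in the row `b.1` and in
the diagonal `b.2`; it holds only steps with content `w q = b.2`; the steps increase strictly along
rows and columns. -/
structure IsStepTableau (w : ℕ → ℕ) (p : ℕ) (c : ℕ → ℕ) (S : ℕ × ℕ → Finset ℕ) : Prop where
  nonempty_iff : ∀ b, (S b).Nonempty ↔ b.1 < c b.2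
  lt : ∀ b, ∀ q ∈ S b, q < p
  content : ∀ b, ∀ q ∈ S b, w q = b.2
  row : ∀ i d, ∀ q ∈ S (i, d), ∀ q' ∈ S (i, d + 1), q < q'
  col : ∀ i d, ∀ q ∈ S (i, d + 1), ∀ q' ∈ S (i + 1, d), q < q'

variable {w : ℕ → ℕ} {p : ℕ} {c : ℕ → ℕ} {S : ℕ × ℕ → Finset ℕ}

theorem IsStepTableau.row_lt (hS : IsStepTableau w p c S) (hc : IsShape c) {i d e q q' : ℕ}
    (hq : q ∈ S (i, d)) (hq' : q' ∈ S (i, d + e + 1)) : q < q' := by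
  induction e generalizing q' with
  | zero => exact hS.row i d q hq q' hq'
  | succ e ih =>
    have h1 : i < c (d + (e + 1) + 1) := (hS.nonempty_iff (i, _)).1 ⟨q', hq'⟩
    obtain ⟨r, hr⟩ := (hS.nonempty_iff (i, d + (e + 1))).2 (h1.trans_le (hc _).1)
    exact (ih hr).trans (hS.row _ _ r hr q' hq')

theorem IsStepTableau.col_lt (hS : IsStepTableau w p c S) (hc : IsShape c) {i d e q q' : ℕ}
    (hq : q ∈ S (i, d + e + 1)) (hq' : q' ∈ S (i + e + 1, d)) : q < q' := by
  induction e generalizing d q' with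
  | zero => exact hS.col i d q hq q' hq'
  | succ e ih =>
    have h1 : i + (e + 1) + 1 < c d := (hS.nonempty_iff (_, d)).1 ⟨q', hq'⟩
    have h2 := (hc d).2
    obtain ⟨r, hr⟩ := (hS.nonempty_iff (i + e + 1, d + 1)).2 (by simp only; omega)
    exact (ih (by rwa [show d + 1 + e + 1 = d + (e + 1) + 1 by omega]) hr).trans
      (hS.col _ _ r hr q' hq')

theorem IsStepTableau.succ (hS : IsStepTableau w p c S) : IsStepTableau w (p + 1) c S :=
  { hS with lt := fun b q hq => (hS.lt b q hq).trans p.lt_succ_self }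

/-- The last step can only be used in a removable box. -/
theorem IsStepTableau.removable_of_mem (hS : IsStepTableau w (p + 1) c S) (hc : IsShape c)
    {b : ℕ × ℕ} (hb : p ∈ S b) : Removable c (w p) ∧ b = (c (w p) - 1, w p) := by
  obtain ⟨i, d⟩ := b
  obtain rfl : w p = d := hS.content _ _ hb
  have h1 : i < c (w p) := (hS.nonempty_iff _).1 ⟨p, hb⟩
  have h2 : c (w p + 1) ≤ i := by
    by_contra! h
    obtain ⟨q, hq⟩ := (hS.nonempty_iff (i, w p + 1)).2 h
    have := hS.row _ _ p hb q hq
    have := hS.lt _ _ hq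
    omega
  have h3 := (hc (w p)).2
  refine ⟨⟨by omega, fun e he => ?_⟩, by rw [show i = c (w p) - 1 by omega]⟩
  have h4 : c e ≤ i + 1 := by
    by_contra! h
    obtain ⟨q, hq⟩ := (hS.nonempty_iff (i + 1, e)).2 h
    have := hS.col i e p (by rwa [he]) q hq
    have := hS.lt _ _ hq
    omega
  have h5 := (hc e).1
  rw [he] at h5
  omega

theorem IsShape.removeBox (hc : IsShape c) {d : ℕ} (hd : Removable c d) :
    IsShape (removeBox c d) := by
  intro e
  have h1 := hc e
  have h2 := hd.1
  have h3 := hd.2 e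
  simp only [ShiftedTableaux.removeBox, Function.update_apply]
  split_ifs with h4 h5 h5
  · omega
  · have := h3 h4
    omega
  · subst h5
    omega
  · exact h1

/-- Use the step `p` in the box `b`. -/
def insertStep (p : ℕ) (b : ℕ × ℕ) (S : ℕ × ℕ → Finset ℕ) : ℕ × ℕ → Finset ℕ :=
  Function.update S b (insert p (S b))

theorem insertStep_self (b : ℕ × ℕ) : insertStep p b S b = insert p (S b) :=
  Function.update_self ..

theorem insertStep_of_ne {a b : ℕ × ℕ} (h : a ≠ b) : insertStep p b S a = S a :=
  Function.update_of_ne h ..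

theorem mem_insertStep {a b : ℕ × ℕ} {q : ℕ} :
    q ∈ insertStep p b S a ↔ q ∈ S a ∨ q = p ∧ a = b := by
  by_cases h : a = b
  · subst h
    rw [insertStep_self, Finset.mem_insert]
    tauto
  · rw [insertStep_of_ne h]
    tauto

theorem IsStepTableau.insertStep {c' : ℕ → ℕ} (hS : IsStepTableau w p c' S)
    (hd : Removable c (w p)) (hc' : c' = c ∨ c' = removeBox c (w p)) :
    IsStepTableau w (p + 1) c (insertStep p (c (w p) - 1, w p) S) where
  nonempty_iff a := by
    have hd1 := hd.1
    by_cases h : a = (c (w p) - 1, w p)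
    · subst h
      rw [insertStep_self]
      refine iff_of_true (Finset.insert_nonempty _ _) ?_
      simp only
      omega
    · rw [insertStep_of_ne h, hS.nonempty_iff]
      rcases hc' with rfl | rfl
      · rfl
      · obtain ⟨i, e⟩ := a
        simp only
        by_cases he : e = w p
        · subst he
          rw [removeBox_self]
          have : i ≠ c (w p) - 1 := fun h' => h (by rw [h'])
          omega
        · rw [removeBox_of_ne _ he]
  lt a q hq := by
    rcases mem_insertStep.1 hq with h | ⟨rfl, -⟩
    · exact (hS.lt _ _ h).trans p.lt_succ_self
    · exact q.lt_succ_self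
  content a q hq := by
    rcases mem_insertStep.1 hq with h | ⟨rfl, rfl⟩
    · exact hS.content _ _ h
    · rfl
  row i d q hq q' hq' := by
    rcases mem_insertStep.1 hq with h | ⟨rfl, h⟩ <;>
      rcases mem_insertStep.1 hq' with h' | ⟨rfl, h'⟩
    · exact hS.row _ _ q h q' h'
    · exact hS.lt _ _ h
    · exfalso
      obtain ⟨rfl, rfl⟩ := Prod.mk.inj h
      have h1 := (hS.nonempty_iff _).1 ⟨q', h'⟩
      have hd1 := hd.1
      simp only at h1
      rcases hc' with rfl | rfl
      · omega
      · rw [removeBox_of_ne _ (by omega)] at h1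
        omega
    · have h1 := (Prod.mk.inj h).2
      have h2 := (Prod.mk.inj h').2
      omega
  col i d q hq q' hq' := by
    rcases mem_insertStep.1 hq with h | ⟨rfl, h⟩ <;>
      rcases mem_insertStep.1 hq' with h' | ⟨rfl, h'⟩
    · exact hS.col _ _ q h q' h'
    · exact hS.lt _ _ h
    · exfalso
      obtain ⟨rfl, hdw⟩ := Prod.mk.inj h
      have h1 := (hS.nonempty_iff _).1 ⟨q', h'⟩
      have hd1 := hd.1
      have hd2 := hd.2 d hdw
      simp only at h1
      rcases hc' with rfl | rfl
      · omega
      · rw [removeBox_of_ne _ (by omega)] at h1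
        omega
    · have h1 := (Prod.mk.inj h).2
      have h2 := (Prod.mk.inj h').2
      omega

theorem IsStepTableau.exists_insertStep (hS : IsStepTableau w (p + 1) c S) (hc : IsShape c)
    {b : ℕ × ℕ} (hb : p ∈ S b) : ∃ S', (IsStepTableau w p c S' ∨
      IsStepTableau w p (removeBox c (w p)) S') ∧
      ShiftedTableaux.insertStep p (c (w p) - 1, w p) S' = S := by
  obtain ⟨hd, rfl⟩ := hS.removable_of_mem hc hb
  set b : ℕ × ℕ := (c (w p) - 1, w p) with hbdef
  set S' := Function.update S b ((S b).erase p) with hS'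
  have hself : S' b = (S b).erase p := Function.update_self ..
  have hne : ∀ a, a ≠ b → S' a = S a := fun a ha => Function.update_of_ne ha ..
  have hsub : ∀ a q, q ∈ S' a → q ∈ S a ∧ q ≠ p := by
    intro a q hq
    by_cases ha : a = b
    · subst ha
      rw [hself, Finset.mem_erase] at hq
      exact hq.symm
    · rw [hne a ha] at hq
      refine ⟨hq, ?_⟩
      rintro rfl
      exact ha (hS.removable_of_mem hc hq).2
  have hlt : ∀ a, ∀ q ∈ S' a, q < p := fun a q hq => by
    have h1 := hS.lt _ _ (hsub a q hq).1
    have h2 := (hsub a q hq).2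
    omega
  have hrest : ∀ c', (∀ a, (S' a).Nonempty ↔ a.1 < c' a.2) → IsStepTableau w p c' S' := fun c' h =>
    { nonempty_iff := h
      lt := hlt
      content := fun a q hq => hS.content _ _ (hsub a q hq).1
      row := fun i d q hq q' hq' => hS.row i d q (hsub _ q hq).1 q' (hsub _ q' hq').1
      col := fun i d q hq q' hq' => hS.col i d q (hsub _ q hq).1 q' (hsub _ q' hq').1 }
  refine ⟨S', ?_, ?_⟩
  · by_cases he : ((S b).erase p).Nonempty
    · left
      refine hrest c fun a => ?_
      by_cases ha : a = b
      · subst ha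
        rw [hself]
        exact iff_of_true he ((hS.nonempty_iff _).1 ⟨p, hb⟩)
      · rw [hne a ha, hS.nonempty_iff]
    · right
      refine hrest _ fun a => ?_
      by_cases ha : a = b
      · rw [ha, hself]
        refine iff_of_false he ?_
        simp only [hbdef, removeBox_self]
        omega
      · rw [hne a ha, hS.nonempty_iff]
        obtain ⟨i, e⟩ := a
        simp only
        by_cases hew : e = w p
        · subst hew
          rw [removeBox_self]
          have : i ≠ c (w p) - 1 := fun h' => ha (by rw [h'])
          omega
        · rw [removeBox_of_ne _ hew]
  · funext a
    by_cases ha : a = b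
    · rw [ha, insertStep_self, hself, Finset.insert_erase hb]
    · rw [insertStep_of_ne ha, hne a ha]

/-- The product of the factors `1 + T (w q)` for `q = p - 1, …, 1, 0`. -/
def stepProd {A : Type*} [Ring A] (T : ℕ → A) (w : ℕ → ℕ) : ℕ → A
  | 0 => 1
  | p + 1 => (1 + T (w p)) * stepProd T w p

/-- The number of step tableaux is a value of a product of operators. -/
theorem encard_stepTableaux (w : ℕ → ℕ) (p : ℕ) (hc : IsShape c) : ∃ k : ℕ,
    {S | IsStepTableau w p c S}.encard = k ∧ stepProd removal w p emptyShape c = k := by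
  induction p generalizing c with
  | zero =>
    by_cases h : ∀ d, c d = 0
    · refine ⟨1, ?_, by simp [stepProd, emptyShape, h]⟩
      have : {S | IsStepTableau w 0 c S} = {fun _ => ∅} := by
        ext S
        simp only [Set.mem_ofPred_eq, Set.mem_singleton_iff]
        constructor
        · intro hS
          funext b
          rw [← Finset.not_nonempty_iff_eq_empty, hS.nonempty_iff, h]
          exact Nat.not_lt_zero _
        · rintro rfl
          constructor <;> simp [h]
      rw [this, Set.encard_singleton]
      rfl
    · refine ⟨0, ?_, by simp [stepProd, emptyShape, h]⟩
      rw [Nat.cast_zero, Set.encard_eq_zero, Set.eq_empty_iff_forall_notMem]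
      intro S hS
      push Not at h
      obtain ⟨d, hd⟩ := h
      obtain ⟨q, hq⟩ := (hS.nonempty_iff (0, d)).2 (Nat.pos_of_ne_zero hd)
      exact Nat.not_lt_zero _ (hS.lt _ _ hq)
  | succ p ih =>
    obtain ⟨k, hk, hk'⟩ := ih hc
    have happ : stepProd removal w (p + 1) emptyShape c = k +
        removal (w p) (stepProd removal w p emptyShape) c := by
      rw [← hk']
      rfl
    by_cases hd : Removable c (w p)
    · obtain ⟨l, hl, hl'⟩ := ih (hc.removeBox hd)
      -- The last step is unused (`k`), shares its box with earlier steps (`k`), or is alone in it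
      -- (`l`, the count for the shape without that box).
      refine ⟨k + (k + l), ?_, ?_⟩
      · set b : ℕ × ℕ := (c (w p) - 1, w p) with hb
        have hset : {S | IsStepTableau w (p + 1) c S} = {S | IsStepTableau w p c S} ∪
            insertStep p b '' ({S | IsStepTableau w p c S} ∪
              {S | IsStepTableau w p (removeBox c (w p)) S}) := by
          ext S
          constructor
          · intro hS
            by_cases h : ∃ a, p ∈ S a
            · obtain ⟨a, ha⟩ := h
              exact Or.inr (hS.exists_insertStep hc ha)
            · refine Or.inl { hS with lt := fun a q hq => ?_ }
              have h1 := hS.lt a q hq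
              have h2 : q ≠ p := by
                rintro rfl
                exact h ⟨a, hq⟩
              omega
          · rintro (hS | ⟨S, hS | hS, rfl⟩)
            · exact hS.succ
            · exact hS.insertStep hd (Or.inl rfl)
            · exact hS.insertStep hd (Or.inr rfl)
        have hnotMem : ∀ S ∈ {S | IsStepTableau w p c S} ∪
            {S | IsStepTableau w p (removeBox c (w p)) S}, p ∉ S b := by
          rintro S (hS | hS) h
          · exact lt_irrefl _ (hS.lt _ _ h)
          · exact lt_irrefl _ (hS.lt _ _ h)
        have hinj : Set.InjOn (insertStep p b) ({S | IsStepTableau w p c S} ∪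
            {S | IsStepTableau w p (removeBox c (w p)) S}) := by
          intro S hS S' hS' h
          funext a
          by_cases ha : a = b
          · have h1 := congrFun h b
            rw [insertStep_self, insertStep_self] at h1
            rw [ha, ← Finset.erase_insert (hnotMem S hS), h1, Finset.erase_insert (hnotMem S' hS')]
          · rw [← insertStep_of_ne (S := S) ha, h, insertStep_of_ne ha]
        rw [hset, Set.encard_union_eq, hinj.encard_image, Set.encard_union_eq, hk, hl]
        · push_cast
          rfl
        · rw [Set.disjoint_left]
          intro S hS hS'
          have h1 := (hS.nonempty_iff b).symm.trans (hS'.nonempty_iff b)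
          have h2 := hd.1
          simp only [hb, removeBox_self] at h1
          omega
        · rw [Set.disjoint_left]
          rintro S hS ⟨S', -, rfl⟩
          have h1 : p ∈ insertStep p b S' b := by simp [insertStep_self]
          exact lt_irrefl _ (hS.lt _ _ h1)
      · rw [happ, removal_apply_of_removable hd, hk', hl']
        push_cast
        rfl
    · refine ⟨k, ?_, by rw [happ, removal_apply_of_not_removable hd, add_zero]⟩
      rw [← hk]
      congr 1
      ext S
      refine ⟨fun hS => { hS with lt := fun a q hq => ?_ }, fun hS => hS.succ⟩
      have h1 := hS.lt a q hq
      have h2 : q ≠ p := by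
        rintro rfl
        exact hd (hS.removable_of_mem hc hq).1
      omega

section Product

variable {A : Type*} [Ring A] (T : ℕ → A)

theorem stepProd_congr {w w' : ℕ → ℕ} {p : ℕ} (h : ∀ q < p, w q = w' q) :
    stepProd T w p = stepProd T w' p := by
  induction p with
  | zero => rfl
  | succ p ih =>
    rw [stepProd, stepProd, h p p.lt_succ_self, ih fun q hq => h q (hq.trans p.lt_succ_self)]

theorem stepProd_add (w : ℕ → ℕ) (a b : ℕ) :
    stepProd T w (a + b) = stepProd T (fun q => w (a + q)) b * stepProd T w a := by
  induction b with
  | zero => simp [stepProd]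
  | succ b ih => rw [← add_assoc, stepProd, stepProd, ih, mul_assoc]

/-- The sequence of contents `m, …, 1, 0, 1, …, m`. -/
def zigzag (m r : ℕ) : ℕ := (m - r) + (r - m)

theorem stepProd_zigzag (m : ℕ) : stepProd T (zigzag m) (2 * m + 1) = transfer T m := by
  induction m with
  | zero => simp [stepProd, transfer, zigzag]
  | succ m ih =>
    rw [show 2 * (m + 1) + 1 = 1 + (2 * m + 1) + 1 by omega, stepProd, stepProd_add]
    have h : (fun q => zigzag (m + 1) (1 + q)) = zigzag m := by
      funext q
      simp only [zigzag]
      omega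
    rw [h, ih, transfer, ← mul_assoc]
    congr 1
    · congr 2
      simp only [zigzag]
      congr 1
      omega
    · simp [stepProd, zigzag]

theorem stepProd_zigzag_mod (m n : ℕ) :
    stepProd T (fun q => zigzag m (q % (2 * m + 1))) (n * (2 * m + 1)) = transfer T m ^ n := by
  induction n with
  | zero => simp [stepProd]
  | succ n ih =>
    rw [add_mul, one_mul, stepProd_add, ih, pow_succ']
    congr 1
    rw [← stepProd_zigzag]
    refine stepProd_congr T fun q hq => ?_
    rw [add_comm, Nat.add_mul_mod_self_right, Nat.mod_eq_of_lt hq]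

end Product

end StepTableaux

/-! ### Set-valued tableaux as step tableaux -/

section Tableaux

theorem letter_lt_iff {n : ℕ} {x y : Letter n} :
    x < y ↔ (ofLex x).1 < (ofLex y).1 ∨
      (ofLex x).1 = (ofLex y).1 ∧ (ofLex x).2 = false ∧ (ofLex y).2 = true := by
  rw [Prod.Lex.lt_iff]
  cases (ofLex x).2 <;> cases (ofLex y).2 <;> simp

theorem letter_ext {n : ℕ} {x y : Letter n} (h1 : (ofLex x).1 = (ofLex y).1)
    (h2 : (ofLex x).2 = (ofLex y).2) : x = y :=
  ofLex.injective (Prod.ext h1 h2)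

theorem eq_primed {n : ℕ} {x : Letter n} (h : (ofLex x).2 = false) : x = primed (ofLex x).1 :=
  letter_ext rfl h

theorem eq_unprimed {n : ℕ} {x : Letter n} (h : (ofLex x).2 = true) :
    x = unprimed (ofLex x).1 :=
  letter_ext rfl h

/-- The step at which a letter is used in a box of content `d`. -/
def step (m : ℕ) {n : ℕ} (d : ℕ) (x : Letter n) : ℕ :=
  (ofLex x).1 * (2 * m + 1) + if (ofLex x).2 then m + d else m - d

variable {m n d e : ℕ} {x y : Letter n}

theorem step_offset_lt (hd : d ≤ m) (u : Bool) :
    (if u then m + d else m - d) < 2 * m + 1 := by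
  cases u <;> simp <;> omega

theorem step_mod (hd : d ≤ m) (x : Letter n) :
    step m d x % (2 * m + 1) = if (ofLex x).2 then m + d else m - d := by
  rw [step, add_comm, Nat.add_mul_mod_self_right, Nat.mod_eq_of_lt (step_offset_lt hd _)]

theorem step_div (hd : d ≤ m) (x : Letter n) :
    step m d x / (2 * m + 1) = (ofLex x).1 := by
  rw [step, add_comm, Nat.add_mul_div_right _ _ (by omega),
    Nat.div_eq_of_lt (step_offset_lt hd _), zero_add]

theorem zigzag_step (hd : d ≤ m) (x : Letter n) : zigzag m (step m d x % (2 * m + 1)) = d := by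
  rw [step_mod hd, zigzag]
  split_ifs <;> omega

theorem step_lt (hd : d ≤ m) (x : Letter n) : step m d x < n * (2 * m + 1) := by
  have h1 := step_offset_lt hd (ofLex x).2
  have h2 : ((ofLex x).1 + 1 : ℕ) * (2 * m + 1) ≤ n * (2 * m + 1) :=
    Nat.mul_le_mul_right _ (ofLex x).1.isLt
  rw [step]
  linarith

theorem step_lt_step_iff (hd : d ≤ m) (he : e ≤ m) :
    step m d x < step m e y ↔ (ofLex x).1 < (ofLex y).1 ∨ (ofLex x).1 = (ofLex y).1 ∧
      (if (ofLex x).2 then m + d else m - d) < if (ofLex y).2 then m + e else m - e := by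
  have h1 := step_offset_lt hd (ofLex x).2
  have h2 := step_offset_lt he (ofLex y).2
  rw [step, step, Fin.lt_def, Fin.ext_iff]
  generalize (if (ofLex x).2 then m + d else m - d) = a at *
  generalize (if (ofLex y).2 then m + e else m - e) = b at *
  rcases lt_trichotomy ((ofLex x).1 : ℕ) (ofLex y).1 with h | h | h
  · have := Nat.mul_le_mul_right (2 * m + 1) (Nat.succ_le_of_lt h)
    rw [Nat.succ_mul] at this
    exact iff_of_true (by omega) (Or.inl h)
  · rw [h]
    simp
  · have := Nat.mul_le_mul_right (2 * m + 1) (Nat.succ_le_of_lt h)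
    rw [Nat.succ_mul] at this
    exact iff_of_false (by omega) (by omega)

/-- Along a row the content grows, so the step of a fixed letter grows if it is unprimed and drops
if it is primed: strict increase of steps allows repeating exactly the unprimed letters. Columns
reverse the roles. -/
theorem step_lt_step_succ_iff (hd : d + 1 ≤ m) :
    step m d x < step m (d + 1) y ↔ x < y ∨ x = y ∧ (ofLex x).2 = true := by
  rw [step_lt_step_iff (by omega) hd, letter_lt_iff]
  constructor
  · rintro (h | ⟨h, h'⟩)
    · exact Or.inl (Or.inl h)
    · cases hx : (ofLex x).2 <;> cases hy : (ofLex y).2 <;>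
        simp only [hx, hy, if_true, Bool.false_eq_true, if_false] at h'
      · omega
      · exact Or.inl (Or.inr ⟨h, rfl, rfl⟩)
      · omega
      · exact Or.inr ⟨letter_ext h (hx.trans hy.symm), rfl⟩
  · rintro ((h | ⟨h, hx, hy⟩) | ⟨rfl, h⟩)
    · exact Or.inl h
    · refine Or.inr ⟨h, ?_⟩
      simp only [hx, hy, if_true, Bool.false_eq_true, if_false]
      omega
    · refine Or.inr ⟨rfl, ?_⟩
      simp [h]

theorem step_succ_lt_step_iff (hd : d + 1 ≤ m) :
    step m (d + 1) x < step m d y ↔ x < y ∨ x = y ∧ (ofLex x).2 = false := by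
  rw [step_lt_step_iff hd (by omega), letter_lt_iff]
  constructor
  · rintro (h | ⟨h, h'⟩)
    · exact Or.inl (Or.inl h)
    · cases hx : (ofLex x).2 <;> cases hy : (ofLex y).2 <;>
        simp only [hx, hy, if_true, Bool.false_eq_true, if_false] at h'
      · exact Or.inr ⟨letter_ext h (hx.trans hy.symm), rfl⟩
      · exact Or.inl (Or.inr ⟨h, rfl, rfl⟩)
      · omega
      · omega
  · rintro ((h | ⟨h, hx, hy⟩) | ⟨rfl, h⟩)
    · exact Or.inl h
    · refine Or.inr ⟨h, ?_⟩
      simp only [hx, hy, if_true, Bool.false_eq_true, if_false]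
      omega
    · refine Or.inr ⟨rfl, ?_⟩
      simp only [h, Bool.false_eq_true, if_false]
      omega

theorem step_injective (hd : d ≤ m) (h : step m d x = step m d y)
    (h0 : d = 0 → (ofLex x).2 = (ofLex y).2) : x = y := by
  have h1 := congrArg (· / (2 * m + 1)) h
  have h2 := congrArg (· % (2 * m + 1)) h
  simp only [step_div hd, step_mod hd] at h1 h2
  refine letter_ext (Fin.ext h1) ?_
  cases hx : (ofLex x).2 <;> cases hy : (ofLex y).2 <;>
    simp only [hx, hy, if_true, Bool.false_eq_true, if_false] at h2 h0
  · rfl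
  · exact (h0 (by omega)).elim
  · exact h0 (by omega)
  · rfl

theorem exists_step_eq {q : ℕ} (hq : q < n * (2 * m + 1)) (hd : d ≤ m)
    (hqd : zigzag m (q % (2 * m + 1)) = d) :
    ∃ x : Letter n, step m d x = q ∧ (d = 0 → (ofLex x).2 = true) := by
  have hs : q / (2 * m + 1) < n := Nat.div_lt_of_lt_mul (by rwa [mul_comm])
  have hdm := Nat.div_add_mod' q (2 * m + 1)
  have hr := Nat.mod_lt q (show 0 < 2 * m + 1 by omega)
  rw [zigzag] at hqd
  generalize q % (2 * m + 1) = r at *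
  -- The centre `r = m` has content `0`, where `s'` and `s` share a step; it is read as the unprimed
  -- letter.
  by_cases h : m ≤ r
  · refine ⟨unprimed ⟨_, hs⟩, ?_, fun _ => rfl⟩
    simp only [step, unprimed, ofLex_toLex, if_true]
    omega
  · refine ⟨primed ⟨_, hs⟩, ?_, fun h0 => by omega⟩
    simp only [step, primed, ofLex_toLex, Bool.false_eq_true, if_false]
    omega

variable {μ : StrictPartition}

/-- The step tableau of a filling. -/
def toSteps (m : ℕ) (T : Filling μ n) (b : ℕ × ℕ) : Finset ℕ :=
  if h : (b.1, b.1 + b.2) ∈ μ.diagram then (T ⟨_, h⟩).image (step m b.2) else ∅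

theorem mem_toSteps {T : Filling μ n} {b : ℕ × ℕ} {q : ℕ} :
    q ∈ toSteps m T b ↔
      ∃ h : (b.1, b.1 + b.2) ∈ μ.diagram, ∃ x ∈ T ⟨_, h⟩, step m b.2 x = q := by
  by_cases h : (b.1, b.1 + b.2) ∈ μ.diagram
  · simp [toSteps, h]
  · simp [toSteps, h]

theorem toSteps_injOn (hm : ∀ i j, (i, j) ∈ μ.diagram → i ≤ j ∧ j - i ≤ m) :
    Set.InjOn (toSteps m) {T : Filling μ n | IsShiftedSetValuedTableau T} := by
  have key : ∀ T T' : Filling μ n, IsShiftedSetValuedTableau T → IsShiftedSetValuedTableau T' →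
      toSteps m T = toSteps m T' → ∀ b, T b ⊆ T' b := by
    rintro T T' hT hT' h ⟨⟨i, j⟩, hb⟩ x hx
    have hij := hm _ _ hb
    obtain ⟨d, rfl⟩ := Nat.exists_eq_add_of_le hij.1
    have h1 : step m d x ∈ toSteps m T (i, d) := mem_toSteps.2 ⟨hb, x, hx, rfl⟩
    rw [h] at h1
    obtain ⟨_, y, hy, hxy⟩ := mem_toSteps.1 h1
    have hd : d ≤ m := by omega
    have : x = y := by
      refine step_injective hd hxy.symm fun h0 => ?_
      subst h0
      have hx' : (ofLex x).2 = true := by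
        by_contra hne
        rw [Bool.not_eq_true] at hne
        exact hT.diagonal _ rfl _ (eq_primed hne ▸ hx)
      have hy' : (ofLex y).2 = true := by
        by_contra hne
        rw [Bool.not_eq_true] at hne
        exact hT'.diagonal ⟨_, hb⟩ rfl _ (eq_primed hne ▸ hy)
      rw [hx', hy']
    rw [this]
    exact hy
  intro T hT T' hT' h
  funext b
  exact (key T T' hT hT' h b).antisymm (key T' T hT' hT h.symm b)

theorem isStepTableau_toSteps {c : ℕ → ℕ} (hD : ∀ i d, (i, i + d) ∈ μ.diagram ↔ i < c d)
    (hcm : ∀ d, m < d → c d = 0) {T : Filling μ n} (hT : IsShiftedSetValuedTableau T) :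
    IsStepTableau (fun q => zigzag m (q % (2 * m + 1))) (n * (2 * m + 1)) c (toSteps m T) := by
  have hdm : ∀ i d, (i, i + d) ∈ μ.diagram → d ≤ m := by
    intro i d h
    by_contra! h'
    have := (hD i d).1 h
    rw [hcm d h'] at this
    omega
  refine ⟨fun b => ⟨?_, fun h => ?_⟩, fun b q hq => ?_, fun b q hq => ?_, ?_, ?_⟩
  · rintro ⟨q, hq⟩
    obtain ⟨h, -⟩ := mem_toSteps.1 hq
    exact (hD _ _).1 h
  · have h' := (hD _ _).2 h
    obtain ⟨x, hx⟩ := hT.nonempty ⟨_, h'⟩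
    exact ⟨_, mem_toSteps.2 ⟨h', x, hx, rfl⟩⟩
  · obtain ⟨h, x, -, rfl⟩ := mem_toSteps.1 hq
    exact step_lt (hdm _ _ h) x
  · obtain ⟨h, x, -, rfl⟩ := mem_toSteps.1 hq
    exact zigzag_step (hdm _ _ h) x
  · intro i d q hq q' hq'
    obtain ⟨h, x, hx, rfl⟩ := mem_toSteps.1 hq
    obtain ⟨h', y, hy, rfl⟩ := mem_toSteps.1 hq'
    refine (step_lt_step_succ_iff (hdm _ _ h')).2 ?_
    rcases (hT.row_le ⟨_, h⟩ ⟨_, h'⟩ rfl x hx y hy).lt_or_eq with hlt | rfl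
    · exact Or.inl hlt
    · refine Or.inr ⟨rfl, ?_⟩
      by_contra hne
      rw [Bool.not_eq_true] at hne
      have := hT.primed_row ⟨_, h⟩ ⟨_, h'⟩ rfl _ (eq_primed hne ▸ hx) (eq_primed hne ▸ hy)
      simp at this
  · intro i d q hq q' hq'
    obtain ⟨h, x, hx, rfl⟩ := mem_toSteps.1 hq
    obtain ⟨h', y, hy, rfl⟩ := mem_toSteps.1 hq'
    refine (step_succ_lt_step_iff (hdm _ _ h)).2 ?_
    have hij : i + 1 + d = i + (d + 1) := by omega
    rcases (hT.col_le ⟨_, h⟩ ⟨_, h'⟩ (by simp [hij]) x hx y hy).lt_or_eq with hlt | rfl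
    · exact Or.inl hlt
    · refine Or.inr ⟨rfl, ?_⟩
      by_contra hne
      rw [Bool.not_eq_false] at hne
      have := hT.unprimed_col ⟨_, h⟩ ⟨_, h'⟩ (by simp [hij]) _ (eq_unprimed hne ▸ hx)
        (eq_unprimed hne ▸ hy)
      simp at this

/-- The uniqueness conditions concern whole rows and columns, not just neighbours, so they use
`row_lt` and `col_lt`; these need `IsShape` to fill the boxes in between. -/
theorem exists_toSteps_eq {c : ℕ → ℕ} (hle : ∀ i j, (i, j) ∈ μ.diagram → i ≤ j)
    (hD : ∀ i d, (i, i + d) ∈ μ.diagram ↔ i < c d) (hc : IsShape c)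
    (hcm : ∀ d, m < d → c d = 0) {S : ℕ × ℕ → Finset ℕ}
    (hS : IsStepTableau (fun q => zigzag m (q % (2 * m + 1))) (n * (2 * m + 1)) c S) :
    ∃ T : Filling μ n, IsShiftedSetValuedTableau T ∧ toSteps m T = S := by
  have hdm : ∀ i d, (i, i + d) ∈ μ.diagram → d ≤ m := by
    intro i d h
    by_contra! h'
    have := (hD i d).1 h
    rw [hcm d h'] at this
    omega
  let T : Filling μ n := fun b => Finset.univ.filter fun x : Letter n =>
    step m (b.1.2 - b.1.1) x ∈ S (b.1.1, b.1.2 - b.1.1) ∧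
      (b.1.2 - b.1.1 = 0 → (ofLex x).2 = true)
  have hTm : ∀ i d (h : (i, i + d) ∈ μ.diagram) x, x ∈ T ⟨_, h⟩ ↔
      step m d x ∈ S (i, d) ∧ (d = 0 → (ofLex x).2 = true) := by
    intro i d h x
    simp only [T, Finset.mem_filter, Finset.mem_univ, true_and, Nat.add_sub_cancel_left]
  have hex : ∀ i d (h : (i, i + d) ∈ μ.diagram), ∀ q ∈ S (i, d), ∃ x ∈ T ⟨_, h⟩,
      step m d x = q := by
    intro i d h q hq
    obtain ⟨x, hx, hx0⟩ := exists_step_eq (hS.lt _ _ hq) (hdm i d h) (hS.content _ _ hq)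
    exact ⟨x, (hTm i d h x).2 ⟨hx ▸ hq, hx0⟩, hx⟩
  refine ⟨T, ⟨?_, ?_, ?_, ?_, ?_, ?_⟩, ?_⟩
  · rintro ⟨⟨i, j⟩, hb⟩
    obtain ⟨d, rfl⟩ := Nat.exists_eq_add_of_le (hle _ _ hb)
    obtain ⟨q, hq⟩ := (hS.nonempty_iff (i, d)).2 ((hD i d).1 hb)
    obtain ⟨x, hx, -⟩ := hex i d hb q hq
    exact ⟨x, hx⟩
  · rintro ⟨⟨i, j⟩, hb⟩ ⟨⟨i', j'⟩, hb'⟩ h x hx y hy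
    obtain ⟨d, rfl⟩ := Nat.exists_eq_add_of_le (hle _ _ hb)
    simp only [Prod.mk.injEq] at h
    obtain ⟨rfl, rfl⟩ := h
    have hx' := ((hTm i' d hb x).1 hx).1
    have hy' := ((hTm i' (d + 1) hb' y).1 hy).1
    rcases (step_lt_step_succ_iff (hdm _ _ hb')).1 (hS.row _ _ _ hx' _ hy') with h | ⟨h, -⟩
    · exact h.le
    · exact h.le
  · rintro ⟨⟨i, j⟩, hb⟩ ⟨⟨i', j'⟩, hb'⟩ h x hx y hy
    simp only [Prod.mk.injEq] at h
    obtain ⟨rfl, rfl⟩ := h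
    obtain ⟨d, rfl⟩ := Nat.exists_eq_add_of_le (hle _ _ hb')
    have hy' := ((hTm (i + 1) d hb' y).1 hy).1
    have hij : i + 1 + d = i + (d + 1) := by omega
    have hb2 : (i, i + (d + 1)) ∈ μ.diagram := hij ▸ hb
    have hx' := ((hTm i (d + 1) hb2 x).1 (by convert hx using 3; simp [hij])).1
    rcases (step_succ_lt_step_iff (hdm _ _ hb2)).1 (hS.col _ _ _ hx' _ hy') with h | ⟨h, -⟩
    · exact h.le
    · exact h.le
  · have key : ∀ i d e (hb : (i, i + (d + e + 1)) ∈ μ.diagram)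
        (hb' : (i + e + 1, i + e + 1 + d) ∈ μ.diagram) s,
        unprimed s ∈ T ⟨_, hb⟩ → unprimed s ∈ T ⟨_, hb'⟩ → False := by
      intro i d e hb hb' s hx hy
      have h := hS.col_lt hc ((hTm _ _ hb _).1 hx).1 ((hTm _ _ hb' _).1 hy).1
      rw [step_lt_step_iff (hdm _ _ hb) (hdm _ _ hb')] at h
      simp [unprimed] at h
      omega
    have key' : ∀ b b' : {b // b ∈ μ.diagram}, b.1.2 = b'.1.2 → b.1.1 < b'.1.1 → ∀ s,
        unprimed s ∈ T b → unprimed s ∈ T b' → False := by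
      rintro ⟨⟨i, j⟩, hb⟩ ⟨⟨i', j'⟩, hb'⟩ h hlt s hx hy
      simp only at h hlt
      subst h
      obtain ⟨e, rfl⟩ := Nat.exists_eq_add_of_le hlt
      obtain ⟨d, rfl⟩ := Nat.exists_eq_add_of_le (hle _ _ hb')
      have h1 : i.succ + e + d = i + (d + e + 1) := by simp only [Nat.succ_eq_add_one]; omega
      have h2 : i.succ + e = i + e + 1 := by simp only [Nat.succ_eq_add_one]; omega
      refine key i d e (h1 ▸ hb) (h2 ▸ hb') s ?_ ?_
      · convert hx using 3
        simp [h1]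
      · convert hy using 3
        simp [h2]
    intro b b' h s hx hy
    rcases lt_trichotomy b.1.1 b'.1.1 with hlt | heq | hlt
    · exact (key' b b' h hlt s hx hy).elim
    · exact Subtype.ext (Prod.ext heq h)
    · exact (key' b' b h.symm hlt s hy hx).elim
  · have key : ∀ i d e (hb : (i, i + d) ∈ μ.diagram) (hb' : (i, i + (d + e + 1)) ∈ μ.diagram) s,
        primed s ∈ T ⟨_, hb⟩ → primed s ∈ T ⟨_, hb'⟩ → False := by
      intro i d e hb hb' s hx hy
      have h := hS.row_lt hc ((hTm _ _ hb _).1 hx).1 ((hTm _ _ hb' _).1 hy).1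
      rw [step_lt_step_iff (hdm _ _ hb) (hdm _ _ hb')] at h
      simp [primed] at h
      omega
    have key' : ∀ b b' : {b // b ∈ μ.diagram}, b.1.1 = b'.1.1 → b.1.2 < b'.1.2 → ∀ s,
        primed s ∈ T b → primed s ∈ T b' → False := by
      rintro ⟨⟨i, j⟩, hb⟩ ⟨⟨i', j'⟩, hb'⟩ h hlt s hx hy
      simp only at h hlt
      subst h
      obtain ⟨d, rfl⟩ := Nat.exists_eq_add_of_le (hle _ _ hb)
      obtain ⟨e, rfl⟩ := Nat.exists_eq_add_of_le hlt
      have h1 : (i + d).succ + e = i + (d + e + 1) := by simp only [Nat.succ_eq_add_one]; omega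
      refine key i d e hb (h1 ▸ hb') s hx ?_
      convert hy using 3
      simp [h1]
    intro b b' h s hx hy
    rcases lt_trichotomy b.1.2 b'.1.2 with hlt | heq | hlt
    · exact (key' b b' h hlt s hx hy).elim
    · exact Subtype.ext (Prod.ext h heq)
    · exact (key' b' b h.symm hlt s hy hx).elim
  · rintro ⟨⟨i, j⟩, hb⟩ h s hs
    simp only at h
    subst h
    have := ((hTm i 0 hb _).1 hs).2 rfl
    simp [primed] at this
  · funext b
    ext q
    rw [mem_toSteps]
    constructor
    · rintro ⟨h, x, hx, rfl⟩
      exact ((hTm _ _ h x).1 hx).1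
    · intro hq
      have h := (hD _ _).2 ((hS.nonempty_iff b).1 ⟨q, hq⟩)
      obtain ⟨x, hx, hxq⟩ := hex _ _ h q hq
      exact ⟨h, x, hx, hxq⟩

theorem card_SSVT_eq {c : ℕ → ℕ} (hle : ∀ i j, (i, j) ∈ μ.diagram → i ≤ j)
    (hD : ∀ i d, (i, i + d) ∈ μ.diagram ↔ i < c d) (hc : IsShape c)
    (hcm : ∀ d, m < d → c d = 0) (n : ℕ) :
    ((SSVT μ n).card : ℤ) = (transfer removal m ^ n) emptyShape c := by
  have hm : ∀ i j, (i, j) ∈ μ.diagram → i ≤ j ∧ j - i ≤ m := by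
    intro i j hb
    obtain ⟨d, rfl⟩ := Nat.exists_eq_add_of_le (hle _ _ hb)
    refine ⟨hle _ _ hb, ?_⟩
    by_contra! h'
    have := (hD i d).1 hb
    simp only [Nat.add_sub_cancel_left] at h'
    rw [hcm d h'] at this
    omega
  obtain ⟨k, hk, hk'⟩ := encard_stepTableaux (fun q => zigzag m (q % (2 * m + 1)))
    (n * (2 * m + 1)) hc
  rw [stepProd_zigzag_mod] at hk'
  rw [hk']
  have himage : {S | IsStepTableau (fun q => zigzag m (q % (2 * m + 1))) (n * (2 * m + 1)) c S} =
      toSteps m '' {T : Filling μ n | IsShiftedSetValuedTableau T} := by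
    ext S
    constructor
    · intro hS
      exact exists_toSteps_eq hle hD hc hcm hS
    · rintro ⟨T, hT, rfl⟩
      exact isStepTableau_toSteps hD hcm hT
  have hcoe : {T : Filling μ n | IsShiftedSetValuedTableau T} = (SSVT μ n : Set (Filling μ n)) := by
    ext T
    simp [SSVT]
  rw [himage, (toSteps_injOn hm).encard_image, hcoe, Set.encard_coe_eq_coe_finsetCard] at hk
  exact_mod_cast hk

theorem eval_GP_one (μ : StrictPartition) (n : ℕ) :
    Polynomial.eval 1 (MvPolynomial.eval (fun _ => 1) (GP μ n)) = ((SSVT μ n).card : ℤ) := by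
  simp [GP, Polynomial.eval_finsetSum]

theorem mem_diagram_shiftedStaircase {k i j : ℕ} :
    (i, j) ∈ (shiftedStaircase k).diagram ↔ i ≤ j ∧ j < k - 1 := by
  rw [StrictPartition.mem_diagram]
  have hlen : (shiftedStaircase k).parts.length = k - 1 := by simp [shiftedStaircase]
  simp only [hlen]
  by_cases hi : i < k - 1
  · have hget : (shiftedStaircase k).parts.getD i 0 = k - 1 - i := by
      rw [List.getD_eq_getElem _ _ (by rw [hlen]; exact hi)]
      simp only [shiftedStaircase, List.getElem_reverse, List.getElem_range', List.length_range']
      omega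
    rw [hget]
    omega
  · omega

end Tableaux

end ShiftedTableaux

theorem proposition5p3 (k n : ℕ) (hk : 1 ≤ k) (hn : k - 1 ≤ n) :
    Polynomial.eval 1 (MvPolynomial.eval (fun _ => 1)
        (ShiftedTableaux.GP (ShiftedTableaux.shiftedStaircase k) n)) =
      ((ShiftedTableaux.SSVT (ShiftedTableaux.shiftedStaircase k) n).card : ℤ) ∧
    3 ^ Nat.choose (k - 1) 2 ∣
      (ShiftedTableaux.SSVT (ShiftedTableaux.shiftedStaircase k) n).card := by
  refine ⟨ShiftedTableaux.eval_GP_one _ _, ?_⟩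
  -- Diagonal `d` of the staircase has `k - 1 - d` boxes. The choice `m = k + 1` exceeds every
  -- content that occurs and is a successor, as the divisibility result requires.
  have hcard := ShiftedTableaux.card_SSVT_eq (μ := ShiftedTableaux.shiftedStaircase k)
    (c := fun d => k - 1 - d) (m := k + 1)
    (fun i j hb => (ShiftedTableaux.mem_diagram_shiftedStaircase.1 hb).1)
    (fun i d => by
      rw [ShiftedTableaux.mem_diagram_shiftedStaircase]
      omega)
    (fun d => by simp only; omega) (fun d hd => by omega) n
  have hdvd := ShiftedTableaux.pow_three_dvd_transfer_emptyShape k n fun d => k - 1 - d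
  rw [← hcard] at hdvd
  simp only [Nat.sub_zero] at hdvd
  exact_mod_cast hdvd
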